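/- Let $(\lambda_n)_{n\ge 1}\subset\mathbb R$ and $r_n>0$ be such that each disk $\mathbb D(\lambda_n,r_n)=\{z:|z-\lambda_n|<r_n\}$ is contained in the open unit disk $\mathbb D$ and the closed disks $\overline{\mathbb D(\lambda_n,r_n)}$ are pairwise disjoint. Put $K=\overline{\mathbb D}\setminus\bigcup_n \mathbb D(\lambda_n,r_n)$ and assume that $K\cap\mathbb R$ has empty interior in $\mathbb R$ and positive length (a "string of beads set"). Let $\Omega=\operatorname{int}(K)$, $\Omega_U=\{z\in\Omega:\operatorname{Im} z>0\}$, $\Omega_L=\Omega\setminus\Omega_U$, $K_U=\overline{\Omega_U}$, $K_L=\overline{\Omega_L}$, and let $A_W=W\,dA$ be the weighted area measure with $W(z)=\operatorname{dist}(z,\mathbb R)^4$ for $z\in\Omega$ and $W(z)=0$ otherwise. For a compact set $F\subset\mathbb C$ and a finite positive Borel measure $\mu$ on $F$, let $\mathrm{Rat}(F)$ be the set of rational functions with poles off $F$ and let $R^2(F,\mu)$ be the closure of $\mathrm{Rat}(F)$ in $L^2(\mu)$. The space $R^2(F,\mu)$ is called pure if it has no direct $L^2$ summand, i.e. there is no Borel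 set $\Delta$ with $\mu(\Delta)>0$ such that $R^2(F,\mu)=L^2(\mu|_\Delta)\oplus N$ for a subspace $N$ of $L^2(\mu|_{\mathbb C\setminus\Delta})$. Let $\mathrm{bpe}(R^2(F,\mu))$ be the set of $z\in F$ such that $f\mapsto f(z)$ is bounded on $\mathrm{Rat}(F)$ for the $L^2(\mu)$ norm, and let $\mathrm{abpe}(R^2(F,\mu))$ be the set of interior points $z_0$ of $\mathrm{bpe}(R^2(F,\mu))$ for which there are $r,M>0$ with $|f(z)|\le M\|f\|_{L^2(\mu)}$ for all $|z-z_0|<r$ and all $f\in\mathrm{Rat}(F)$. Then $R^2(K,A_W)$ is pure, $\mathrm{abpe}(R^2(K,A_W))=\Omega$, the characteristic function $\chi_{\Omega_U}$ belongs to $R^2(K,A_W)$, and $R^2(K,A_W)$ splits non-trivially as the orthogonal direct sum \[ R^2(K,A_W)=R^2(K_U,A_W|_{\Omega_U})\oplus R^2(K_L,A_W|_{\Omega_L}), \] where functions on $\Omega_U$ and on $\Omega_L$ are extended by zero and $A_W(\Omega_U)>0$, $A_W(\Omega_L)>0$. -/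

import Mathlib

open MeasureTheory
open scoped ENNReal NNReal

noncomputable section

namespace StringOfBeads

/-! ### The spaces `R^t(K, μ)`

Here `K` is a compact subset of `ℂ` and `μ` is a finite Borel measure carried by `K`. -/

/-- `Rat(K)`: the rational functions `p / q` with poles off `K`. Only the values at points of `K`
are meaningful (elsewhere `q` may vanish, and division by zero gives the value `0`). -/
def Rat (K : Set ℂ) : Set (ℂ → ℂ) :=
  {f | ∃ p q : Polynomial ℂ, (∀ z ∈ K, q.eval z ≠ 0) ∧ f = fun z => p.eval z / q.eval z}

/-- `R^t(K, μ)`: the closure of `Rat(K)` in `L^t(μ)`. When `μ` is carried by `K`, the classes of the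
members of `Rat(K)` already form a linear subspace, so that the span adds nothing. -/
def R (K : Set ℂ) (t : ℝ≥0∞) [Fact (1 ≤ t)] (μ : Measure ℂ) : Submodule ℂ (Lp ℂ t μ) :=
  (Submodule.span ℂ {f : Lp ℂ t μ | ∃ g ∈ Rat K, f =ᵐ[μ] g}).topologicalClosure

/-- The bounded point evaluations for `R^t(K, μ)`: the points `z` at which `f ↦ f z` is defined on
all of `Rat(K)` (that is, `z ∈ K`) and bounded with respect to the `L^t(μ)` norm. -/
def bpe (K : Set ℂ) (t : ℝ≥0∞) (μ : Measure ℂ) : Set ℂ :=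
  {z | z ∈ K ∧ ∃ M : ℝ≥0, ∀ f ∈ Rat K, ‖f z‖ₑ ≤ M * eLpNorm f t μ}

/-- The analytic bounded point evaluations for `R^t(K, μ)`. -/
def abpe (K : Set ℂ) (t : ℝ≥0∞) (μ : Measure ℂ) : Set ℂ :=
  {z₀ | z₀ ∈ interior (bpe K t μ) ∧ ∃ r : ℝ, 0 < r ∧ ∃ M : ℝ≥0,
    ∀ z ∈ Metric.ball z₀ r, ∀ f ∈ Rat K, ‖f z‖ₑ ≤ M * eLpNorm f t μ}

/-- A subspace `N` of `L^t(μ|_A)` regarded as a subspace of `L^t(μ)` through extension by zero: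
the `f ∈ L^t(μ)` that vanish a.e. off `A` and whose restriction to `A` lies in `N`. -/
def extendByZero {t : ℝ≥0∞} [Fact (1 ≤ t)] {μ : Measure ℂ} (A : Set ℂ)
    (N : Submodule ℂ (Lp ℂ t (μ.restrict A))) : Submodule ℂ (Lp ℂ t μ) :=
  N.comap (LpToLpRestrictCLM ℂ ℂ ℂ μ t A).toLinearMap ⊓
    LinearMap.ker (LpToLpRestrictCLM ℂ ℂ ℂ μ t Aᶜ).toLinearMap

/-- Multiplication by `z` on `R^t(K, μ)` is pure: `R^t(K, μ)` has no direct `L^t` summand, i.e. there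
is no Borel set `Δ` with `μ(Δ) > 0` and no subspace `N` of `L^t(μ|_{Δᶜ})` such that
`R^t(K, μ) = L^t(μ|_Δ) ⊕ N`. -/
def IsPure (K : Set ℂ) (t : ℝ≥0∞) [Fact (1 ≤ t)] (μ : Measure ℂ) : Prop :=
  ¬ ∃ Δ : Set ℂ, MeasurableSet Δ ∧ 0 < μ Δ ∧ ∃ N : Submodule ℂ (Lp ℂ t (μ.restrict Δᶜ)),
    R K t μ = extendByZero Δ ⊤ ⊔ extendByZero Δᶜ N

/-! ### String of beads sets -/

/-- The closed unit disk with the open disks of centre `lam n` and radius `r n` removed. -/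
def beadSet (lam r : ℕ → ℝ) : Set ℂ :=
  Metric.closedBall (0 : ℂ) 1 \ ⋃ n, Metric.ball (lam n : ℂ) (r n)

/-- The centres `lam n` and the radii `r n` define a string of beads set `beadSet lam r`. -/
structure IsStringOfBeads (lam r : ℕ → ℝ) : Prop where
  radius_pos : ∀ n, 0 < r n
  ball_subset : ∀ n, Metric.ball (lam n : ℂ) (r n) ⊆ Metric.ball (0 : ℂ) 1
  disjoint : ∀ i j, i ≠ j →
    Disjoint (Metric.closedBall (lam i : ℂ) (r i)) (Metric.closedBall (lam j : ℂ) (r j))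
  real_interior : interior {x : ℝ | (x : ℂ) ∈ beadSet lam r} = ∅
  real_length_pos : 0 < volume {x : ℝ | (x : ℂ) ∈ beadSet lam r}

/-- `Ω = int(K)`. -/
def Om (K : Set ℂ) : Set ℂ := interior K

/-- `Ω_U`, the part of `Ω` in the open upper half plane. -/
def OmU (K : Set ℂ) : Set ℂ := {z ∈ Om K | 0 < z.im}

/-- `Ω_L = Ω \ Ω_U`. -/
def OmL (K : Set ℂ) : Set ℂ := Om K \ OmU K

/-- `K_U`, the closure of `Ω_U`. -/
def KU (K : Set ℂ) : Set ℂ := closure (OmU K)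

/-- `K_L`, the closure of `Ω_L`. -/
def KL (K : Set ℂ) : Set ℂ := closure (OmL K)

/-- The weight `W(z) = dist(z, ℝ)^4` on `Ω`, and `0` off `Ω`. -/
def weight (K : Set ℂ) : ℂ → ℝ :=
  (Om K).indicator fun z => Metric.infDist z (Set.range ((↑) : ℝ → ℂ)) ^ 4

/-- The weighted area measure `W dA`. -/
def areaW (K : Set ℂ) : Measure ℂ :=
  (volume : Measure ℂ).withDensity fun z => ENNReal.ofReal (weight K z)

end StringOfBeads

end

/-!
For `|c| = 1` the zeros of `(w + i)ⁿ - c (w - i)ⁿ` are real, and `K ∩ ℝ` is closed without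
interior, so by Baire `c` can be chosen to keep them off `K`. The rational functions
`(w + i)ⁿ / ((w + i)ⁿ - c (w - i)ⁿ)` then tend to `1` above and to `0` below the real axis,
dominated by a multiple of `1 / |Im w|`, which the weight makes integrable to the power `4`. Hence
`χ_{Ω_U}` lies in `R²(K, W dA)`, and multiplication by it splits that space. A pole off `K_U` may
still lie in `K`; but then it is a boundary point of `K` or lies in the lower half plane, and in
both cases `1 / (w - a)` is on `Ω_U` a uniform limit of members of `Rat(K)`.

By the area mean value property every point of `Ω` is an analytic bounded point evaluation. So the
members of `R²(K, W dA)` have holomorphic representatives on `Ω`, and the characteristic function of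
a small set of positive measure, which a direct `L²` summand would contain, has none.
-/

namespace StringOfBeads

section WeightedArea

theorem infDist_range_ofReal (z : ℂ) :
    Metric.infDist z (Set.range ((↑) : ℝ → ℂ)) = |z.im| := by
  refine le_antisymm ?_ ((Metric.le_infDist (Set.range_nonempty _)).2 ?_)
  · refine (Metric.infDist_le_dist_of_mem (Set.mem_range_self z.re)).trans_eq ?_
    simp [Complex.dist_of_re_eq]
  · rintro _ ⟨x, rfl⟩
    simpa [Complex.dist_eq] using Complex.abs_im_le_norm (z - x)

theorem isOpen_Om (K : Set ℂ) : IsOpen (Om K) := isOpen_interior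

theorem isOpen_OmU (K : Set ℂ) : IsOpen (OmU K) :=
  (isOpen_Om K).inter (isOpen_lt continuous_const Complex.continuous_im)

theorem im_ne_zero_of_mem_Om {K : Set ℂ} (hint : interior {x : ℝ | (x : ℂ) ∈ K} = ∅) {z : ℂ}
    (hz : z ∈ Om K) : z.im ≠ 0 := by
  intro hz0
  have hzre : (z.re : ℂ) = z := Complex.ext rfl (by simp [hz0])
  have hmem : z.re ∈ interior {x : ℝ | (x : ℂ) ∈ K} :=
    preimage_interior_subset_interior_preimage Complex.continuous_ofReal (by
      rwa [Set.mem_preimage, hzre])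
  simp [hint] at hmem

theorem OmL_eq {K : Set ℂ} (him : ∀ z ∈ Om K, z.im ≠ 0) : OmL K = {z ∈ Om K | z.im < 0} := by
  ext z
  simp only [OmL, OmU, Set.mem_sdiff, Set.mem_sep_iff, not_and, not_lt]
  exact and_congr_right fun hz => ⟨fun h => (h hz).lt_of_ne (him z hz), fun h _ => h.le⟩

theorem isOpen_OmL {K : Set ℂ} (him : ∀ z ∈ Om K, z.im ≠ 0) : IsOpen (OmL K) := by
  rw [OmL_eq him]
  exact (isOpen_Om K).inter (isOpen_lt Complex.continuous_im continuous_const)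

theorem areaW_eq (K : Set ℂ) :
    areaW K = (volume.restrict (Om K)).withDensity fun z => ENNReal.ofReal (|z.im| ^ 4) := by
  rw [areaW, ← withDensity_indicator (isOpen_Om K).measurableSet]
  congr 1
  ext z
  by_cases hz : z ∈ Om K <;> simp [weight, hz, infDist_range_ofReal]

theorem ae_mem_Om (K : Set ℂ) : ∀ᵐ z ∂areaW K, z ∈ Om K := by
  rw [areaW_eq]
  exact (withDensity_absolutelyContinuous _ _).ae_le (ae_restrict_mem (isOpen_Om K).measurableSet)

theorem ae_mem_of_areaW (K : Set ℂ) : ∀ᵐ z ∂areaW K, z ∈ K :=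
  (ae_mem_Om K).mono fun _ hz => interior_subset hz

theorem isFiniteMeasure_areaW {K : Set ℂ} (hK : IsCompact K) : IsFiniteMeasure (areaW K) := by
  rw [areaW_eq]
  have hcont : ContinuousOn (fun z : ℂ => |z.im| ^ 4) K := by fun_prop
  exact isFiniteMeasure_withDensity_ofReal
    ((hcont.integrableOn_compact hK).mono_set interior_subset).2

theorem restrict_absolutelyContinuous_areaW {K : Set ℂ} (him : ∀ z ∈ Om K, z.im ≠ 0) :
    volume.restrict (Om K) ≪ areaW K := by
  rw [areaW_eq]
  refine withDensity_absolutelyContinuous' (by fun_prop) ?_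
  filter_upwards [ae_restrict_mem (isOpen_Om K).measurableSet] with z hz
  have := abs_pos.2 (him z hz)
  positivity

theorem areaW_ne_zero_of_isOpen {K : Set ℂ} (him : ∀ z ∈ Om K, z.im ≠ 0) {U : Set ℂ}
    (hU : IsOpen U) (hne : U.Nonempty) (hUK : U ⊆ Om K) : areaW K U ≠ 0 := by
  intro h0
  have hvol := restrict_absolutelyContinuous_areaW him h0
  rw [Measure.restrict_apply hU.measurableSet, Set.inter_eq_left.2 hUK] at hvol
  exact (hU.measure_pos volume hne).ne' hvol

theorem memLp_inv_im {K : Set ℂ} (hK : IsCompact K) :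
    MemLp (fun z : ℂ => z.im⁻¹) 4 (areaW K) := by
  have hmeas : Measurable fun z : ℂ => z.im⁻¹ := Complex.measurable_im.inv
  refine ⟨hmeas.aestronglyMeasurable, ?_⟩
  rw [eLpNorm_lt_top_iff_lintegral_rpow_enorm_lt_top (by norm_num) (by norm_num), areaW_eq,
    lintegral_withDensity_eq_lintegral_mul _ (by fun_prop) (hmeas.enorm.pow_const _)]
  have hvol : volume (Om K) < ∞ := (measure_mono interior_subset).trans_lt hK.measure_lt_top
  refine (lintegral_mono (g := fun _ => 1) fun z => ?_).trans_lt (by simpa using hvol)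
  simp only [Pi.mul_apply, ENNReal.toReal_ofNat, ENNReal.rpow_ofNat]
  rw [← ofReal_norm, ← ENNReal.ofReal_pow (norm_nonneg _), ← ENNReal.ofReal_mul (by positivity),
    ENNReal.ofReal_le_one, norm_inv, Real.norm_eq_abs, inv_pow]
  exact mul_inv_le_one

end WeightedArea

section RationalFunctions

variable {K : Set ℂ} {f g : ℂ → ℂ}

theorem eval_mem_Rat (K : Set ℂ) (p : Polynomial ℂ) : (fun z => p.eval z) ∈ Rat K :=
  ⟨p, 1, by simp, by simp⟩

theorem mul_mem_Rat (hf : f ∈ Rat K) (hg : g ∈ Rat K) : (fun z => f z * g z) ∈ Rat K := by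
  obtain ⟨p, q, hq, rfl⟩ := hf
  obtain ⟨p', q', hq', rfl⟩ := hg
  refine ⟨p * p', q * q', fun z hz => ?_, ?_⟩
  · simpa using ⟨hq z hz, hq' z hz⟩
  · simp [div_mul_div_comm]

theorem const_smul_mem_Rat (c : ℂ) (hf : f ∈ Rat K) : c • f ∈ Rat K := by
  simpa using! mul_mem_Rat (eval_mem_Rat K (Polynomial.C c)) hf

-- At a zero of a denominator off `K` the junk value `0` may differ from the sum, hence `EqOn`.
theorem exists_mem_Rat_eqOn_add (hf : f ∈ Rat K) (hg : g ∈ Rat K) :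
    ∃ h ∈ Rat K, Set.EqOn h (f + g) K := by
  obtain ⟨p, q, hq, rfl⟩ := hf
  obtain ⟨p', q', hq', rfl⟩ := hg
  refine ⟨_, ⟨p * q' + q * p', q * q', fun z hz => ?_, rfl⟩, fun z hz => ?_⟩
  · simpa using ⟨hq z hz, hq' z hz⟩
  · simp [div_add_div _ _ (hq z hz) (hq' z hz)]

theorem exists_mem_Rat_eqOn_sub (hf : f ∈ Rat K) (hg : g ∈ Rat K) :
    ∃ h ∈ Rat K, Set.EqOn h (f - g) K := by
  simpa [sub_eq_add_neg] using exists_mem_Rat_eqOn_add hf (const_smul_mem_Rat (-1) hg)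

theorem inv_sub_mem_Rat {a : ℂ} (ha : a ∉ K) : (fun z => (z - a)⁻¹) ∈ Rat K := by
  refine ⟨1, Polynomial.X - Polynomial.C a, fun z hz hza => ha ?_, by simp⟩
  rwa [← sub_eq_zero.1 (by simpa using hza : z - a = 0)]

theorem Rat_anti {L : Set ℂ} (h : K ⊆ L) : Rat L ⊆ Rat K := by
  rintro f ⟨p, q, hq, rfl⟩
  exact ⟨p, q, fun z hz => hq z (h hz), rfl⟩

theorem exists_eq_eval_mul_prod_inv_sub (hf : f ∈ Rat K) :
    ∃ (p : Polynomial ℂ) (s : Multiset ℂ), (∀ a ∈ s, a ∉ K) ∧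
      f = fun z => p.eval z * (s.map fun a => (z - a)⁻¹).prod := by
  obtain ⟨p, q, hq, rfl⟩ := hf
  refine ⟨Polynomial.C q.leadingCoeff⁻¹ * p, q.roots,
    fun a ha haK => hq a haK (Polynomial.isRoot_of_mem_roots ha), funext fun z => ?_⟩
  have hroots : q.eval z = q.leadingCoeff * (q.roots.map fun a => z - a).prod :=
    (IsAlgClosed.splits q).eval_eq_prod_roots z
  rw [hroots, Multiset.prod_map_inv, Polynomial.eval_mul, Polynomial.eval_C, div_eq_mul_inv,
    mul_inv]
  ring

theorem measurable_of_mem_Rat (hf : f ∈ Rat K) : Measurable f := by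
  obtain ⟨p, q, -, rfl⟩ := hf
  exact p.continuous.measurable.div q.continuous.measurable

theorem differentiableOn_of_mem_Rat (hf : f ∈ Rat K) : DifferentiableOn ℂ f K := by
  obtain ⟨p, q, hq, rfl⟩ := hf
  exact p.differentiable.differentiableOn.div q.differentiable.differentiableOn hq

theorem exists_bound_of_mem_Rat (hK : IsCompact K) (hf : f ∈ Rat K) :
    ∃ C : ℝ, ∀ z ∈ K, ‖f z‖ ≤ C :=
  hK.exists_bound_of_continuousOn (differentiableOn_of_mem_Rat hf).continuousOn

theorem memLp_of_mem_Rat (hK : IsCompact K) {t : ℝ≥0∞} {μ : Measure ℂ} [IsFiniteMeasure μ]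
    (hμ : ∀ᵐ z ∂μ, z ∈ K) (hf : f ∈ Rat K) : MemLp f t μ := by
  obtain ⟨C, hC⟩ := exists_bound_of_mem_Rat hK hf
  exact .of_bound (measurable_of_mem_Rat hf).aestronglyMeasurable C (hμ.mono hC)

theorem exists_mem_Rat_of_mem_span {t : ℝ≥0∞} {μ : Measure ℂ} (hμ : ∀ᵐ z ∂μ, z ∈ K)
    {F : Lp ℂ t μ} (hF : F ∈ Submodule.span ℂ {f : Lp ℂ t μ | ∃ g ∈ Rat K, f =ᵐ[μ] g}) :
    ∃ g ∈ Rat K, F =ᵐ[μ] g := by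
  induction hF using Submodule.span_induction with
  | mem _ hF => exact hF
  | zero => exact ⟨_, eval_mem_Rat K 0, by simpa using! Lp.coeFn_zero ℂ t μ⟩
  | add F G _ _ hF hG =>
    obtain ⟨f, hf, hFf⟩ := hF
    obtain ⟨g, hg, hGg⟩ := hG
    obtain ⟨h, hh, hsum⟩ := exists_mem_Rat_eqOn_add hf hg
    exact ⟨h, hh, ((Lp.coeFn_add F G).trans (hFf.add hGg)).trans
      (hμ.mono fun z hz => (hsum hz).symm)⟩
  | smul c F _ hF =>
    obtain ⟨f, hf, hFf⟩ := hF
    exact ⟨c • f, const_smul_mem_Rat c hf, (Lp.coeFn_smul c F).trans (hFf.const_smul c)⟩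

end RationalFunctions

section MemR

/-- The class of the function `f` belongs to `R^t(K, μ)`; this allows pointwise arguments about
functions rather than classes in `L^t(μ)`. -/
def MemR (K : Set ℂ) (t : ℝ≥0∞) [Fact (1 ≤ t)] (μ : Measure ℂ) (f : ℂ → ℂ) : Prop :=
  ∃ F ∈ R K t μ, F =ᵐ[μ] f

variable {K : Set ℂ} {t : ℝ≥0∞} [Fact (1 ≤ t)] {μ : Measure ℂ} {f g : ℂ → ℂ}

theorem MemR.memLp (hf : MemR K t μ f) : MemLp f t μ := by
  obtain ⟨F, -, hF⟩ := hf
  exact (memLp_congr_ae hF).1 (Lp.memLp F)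

theorem MemR.congr (hf : MemR K t μ f) (h : f =ᵐ[μ] g) : MemR K t μ g := by
  obtain ⟨F, hF, hFf⟩ := hf
  exact ⟨F, hF, hFf.trans h⟩

theorem memR_coe_iff {F : Lp ℂ t μ} : MemR K t μ F ↔ F ∈ R K t μ := by
  refine ⟨?_, fun hF => ⟨F, hF, .rfl⟩⟩
  rintro ⟨G, hG, hGF⟩
  rwa [← Lp.ext hGF]

theorem memR_iff_toLp_mem (hf : MemLp f t μ) : MemR K t μ f ↔ hf.toLp f ∈ R K t μ := by
  rw [← memR_coe_iff]
  exact ⟨fun h => h.congr hf.coeFn_toLp.symm, fun h => h.congr hf.coeFn_toLp⟩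

theorem MemR.sub (hf : MemR K t μ f) (hg : MemR K t μ g) : MemR K t μ (f - g) := by
  obtain ⟨F, hF, hFf⟩ := hf
  obtain ⟨G, hG, hGg⟩ := hg
  exact ⟨F - G, sub_mem hF hG, (Lp.coeFn_sub F G).trans (hFf.sub hGg)⟩

theorem MemR.of_mem_Rat (hf : f ∈ Rat K) (hfLp : MemLp f t μ) : MemR K t μ f :=
  ⟨hfLp.toLp f,
    Submodule.le_topologicalClosure _ (Submodule.subset_span ⟨f, hf, hfLp.coeFn_toLp⟩),
    hfLp.coeFn_toLp⟩

theorem MemR.of_tendsto {u : ℕ → ℂ → ℂ} (hu : ∀ n, MemR K t μ (u n)) (hf : MemLp f t μ)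
    (h : Filter.Tendsto (fun n => eLpNorm (u n - f) t μ) Filter.atTop (nhds 0)) :
    MemR K t μ f := by
  have hlim := (Lp.tendsto_Lp_iff_tendsto_eLpNorm'' u (fun n => (hu n).memLp) f hf).2 h
  exact (memR_iff_toLp_mem hf).2 <|
    (Submodule.isClosed_topologicalClosure _).mem_of_tendsto hlim
      (.of_forall fun n => (memR_iff_toLp_mem (hu n).memLp).1 (hu n))

theorem MemR.exists_seq_tendsto (hμ : ∀ᵐ z ∂μ, z ∈ K) (hf : MemR K t μ f) :
    ∃ u : ℕ → ℂ → ℂ, (∀ n, u n ∈ Rat K ∧ MemLp (u n) t μ) ∧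
      Filter.Tendsto (fun n => eLpNorm (u n - f) t μ) Filter.atTop (nhds 0) := by
  have hfR := (memR_iff_toLp_mem hf.memLp).1 hf
  obtain ⟨F, hF, hlim⟩ := mem_closure_iff_seq_limit.1 hfR
  choose u hu hFu using fun n => exists_mem_Rat_of_mem_span hμ (hF n)
  have huLp : ∀ n, MemLp (u n) t μ := fun n => (memLp_congr_ae (hFu n)).1 (Lp.memLp _)
  refine ⟨u, fun n => ⟨hu n, huLp n⟩,
    (Lp.tendsto_Lp_iff_tendsto_eLpNorm'' u huLp f hf.memLp).1 (hlim.congr fun n => ?_)⟩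
  exact Lp.ext ((hFu n).trans (huLp n).coeFn_toLp.symm)

theorem MemR.rat_mul (hK : IsCompact K) (hμ : ∀ᵐ z ∂μ, z ∈ K) (hg : g ∈ Rat K)
    (hf : MemR K t μ f) : MemR K t μ fun z => g z * f z := by
  obtain ⟨C, hC⟩ := exists_bound_of_mem_Rat hK hg
  obtain ⟨u, hu, hlim⟩ := hf.exists_seq_tendsto hμ
  have hgm := (measurable_of_mem_Rat hg).aestronglyMeasurable (μ := μ)
  have hgLp : ∀ {h : ℂ → ℂ}, MemLp h t μ → MemLp (fun z => g z * h z) t μ := fun hh =>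
    hh.of_le_mul (hgm.mul hh.1) (c := C) <| hμ.mono fun z hz => by
      rw [norm_mul]
      gcongr
      exact hC z hz
  refine .of_tendsto (u := fun n z => g z * u n z)
    (fun n => .of_mem_Rat (mul_mem_Rat hg (hu n).1) (hgLp (hu n).2))
    (hgLp hf.memLp) ?_
  have hbound : ∀ n, eLpNorm ((fun z => g z * u n z) - fun z => g z * f z) t μ ≤
      ENNReal.ofReal C * eLpNorm (u n - f) t μ := fun n =>
    eLpNorm_le_mul_eLpNorm_of_ae_le_mul (hμ.mono fun z hz => by
      simp only [Pi.sub_apply, ← mul_sub, norm_mul]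
      gcongr
      exact hC z hz) t
  refine tendsto_of_tendsto_of_tendsto_of_le_of_le tendsto_const_nhds ?_ (fun _ => zero_le) hbound
  simpa using ENNReal.Tendsto.const_mul hlim (Or.inr ENNReal.ofReal_ne_top)

theorem MemR.mono_measure {V : Set ℂ} {ν : Measure ℂ} (hVK : V ⊆ K) (hνμ : ν ≤ μ)
    (hμ : ∀ᵐ z ∂μ, z ∈ K) (hf : MemR K t μ f) : MemR V t ν f := by
  obtain ⟨u, hu, hlim⟩ := hf.exists_seq_tendsto hμ
  refine .of_tendsto (fun n => .of_mem_Rat (Rat_anti hVK (hu n).1) ((hu n).2.mono_measure hνμ))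
    (hf.memLp.mono_measure hνμ) ?_
  exact tendsto_of_tendsto_of_tendsto_of_le_of_le tendsto_const_nhds hlim (fun _ => zero_le)
    fun n => eLpNorm_mono_measure _ hνμ

end MemR

section SplittingFunction

open UpperHalfPlane (upperHalfPlaneSet)

theorem tendsto_eLpNorm_of_dominated {α E : Type*} [MeasurableSpace α] [NormedAddCommGroup E]
    {μ : Measure α} {p : ℝ≥0∞} (hp : p ≠ ∞) {u : ℕ → α → E} {f : α → E} {G : α → ℝ}
    (hu : ∀ n, AEStronglyMeasurable (u n) μ) (hf : AEStronglyMeasurable f μ) (hG : MemLp G p μ)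
    (hbound : ∀ n, ∀ᵐ x ∂μ, ‖u n x - f x‖ ≤ G x)
    (hlim : ∀ᵐ x ∂μ, Filter.Tendsto (fun n => u n x) Filter.atTop (nhds (f x))) :
    Filter.Tendsto (fun n => eLpNorm (u n - f) p μ) Filter.atTop (nhds 0) := by
  rcases eq_or_ne p 0 with rfl | hp0
  · simp
  have hp' : 0 < p.toReal := ENNReal.toReal_pos hp0 hp
  have hint : Filter.Tendsto (fun n => ∫⁻ x, ‖u n x - f x‖ₑ ^ p.toReal ∂μ) Filter.atTop
      (nhds (∫⁻ _, 0 ∂μ)) := by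
    refine tendsto_lintegral_of_dominated_convergence' (fun x => ‖G x‖ₑ ^ p.toReal)
      (fun n => ((hu n).sub hf).enorm.pow_const _) (fun n => ?_) ?_ ?_
    · filter_upwards [hbound n] with x hx
      gcongr
      exact enorm_le_iff_norm_le.2 (hx.trans (le_abs_self _))
    · exact ((eLpNorm_lt_top_iff_lintegral_rpow_enorm_lt_top hp0 hp).1 hG.2).ne
    · filter_upwards [hlim] with x hx
      have hsub : Filter.Tendsto (fun n => u n x - f x) Filter.atTop (nhds 0) := by
        simpa using hx.sub_const (f x)
      simpa [hp', Function.comp_def] using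
        ((ENNReal.continuous_rpow_const (y := p.toReal)).tendsto _).comp hsub.enorm
  have hroot := ((ENNReal.continuous_rpow_const (y := 1 / p.toReal)).tendsto _).comp hint
  rw [lintegral_zero, ENNReal.zero_rpow_of_pos (by positivity)] at hroot
  exact hroot.congr fun n => (eLpNorm_eq_lintegral_rpow_enorm_toReal hp0 hp).symm

theorem interior_image_eq_empty {X Y : Type*} [TopologicalSpace X] [TopologicalSpace Y]
    {f : X → Y} (hf : Continuous f) (hinj : f.Injective) {S : Set X} (hS : interior S = ∅) :
    interior (f '' S) = ∅ := by
  refine Set.eq_empty_of_forall_notMem fun y hy => ?_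
  obtain ⟨x, -, rfl⟩ := interior_subset hy
  have hx := preimage_interior_subset_interior_preimage hf hy
  rw [hinj.preimage_image, hS] at hx
  exact hx

theorem exists_forall_mul_notMem {G : Type*} [Group G] [TopologicalSpace G]
    [ContinuousConstSMul G G] [BaireSpace G] {S Z : Set G} (hSc : IsClosed S)
    (hS : interior S = ∅) (hZ : Z.Countable) : ∃ g, ∀ z ∈ Z, z * g ∉ S := by
  have hdense : Dense (⋂ z ∈ Z, {g : G | z * g ∉ S}) := by
    refine dense_biInter_of_isOpen (fun z _ => ?_) hZ fun z _ => ?_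
    · exact hSc.isOpen_compl.preimage (continuous_const_smul z)
    · exact (interior_eq_empty_iff_dense_compl.1 hS).preimage (isOpenMap_smul z)
  obtain ⟨g, hg⟩ := hdense.nonempty
  exact ⟨g, by simpa using hg⟩

theorem normSq_add_I_sub_normSq_sub_I (w : ℂ) :
    ‖w + Complex.I‖ ^ 2 - ‖w - Complex.I‖ ^ 2 = 4 * w.im := by
  rw [← Complex.normSq_eq_norm_sq, ← Complex.normSq_eq_norm_sq, Complex.normSq_apply,
    Complex.normSq_apply]
  simp only [Complex.add_re, Complex.add_im, Complex.sub_re, Complex.sub_im, Complex.I_re,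
    Complex.I_im]
  ring

theorem ofReal_sub_I_ne_zero (x : ℝ) : (x : ℂ) - Complex.I ≠ 0 := fun h => by
  simpa using congrArg Complex.im h

/-- The Cayley transform `x ↦ (x + i) / (x - i)` of the real line into the unit circle. It turns the
equation `(x + i)ⁿ = c (x - i)ⁿ` into `cayley x ^ n = c`. -/
noncomputable def cayley (x : ℝ) : Circle :=
  .ofConjDivSelf (x - Complex.I) (ofReal_sub_I_ne_zero x)

theorem coe_cayley (x : ℝ) : (cayley x : ℂ) = (x + Complex.I) / (x - Complex.I) := by
  simp [cayley, Circle.ofConjDivSelf]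

theorem continuous_cayley : Continuous cayley := by
  refine Topology.IsInducing.subtypeVal.continuous_iff.2 ((?_ : Continuous _).congr fun x =>
    (coe_cayley x).symm)
  exact (by fun_prop : Continuous fun x : ℝ => (x : ℂ) + Complex.I).div (by fun_prop)
    ofReal_sub_I_ne_zero

theorem injective_cayley : Function.Injective cayley := by
  intro x y hxy
  have h : (cayley x : ℂ) = cayley y := congrArg _ hxy
  rw [coe_cayley, coe_cayley, div_eq_div_iff (ofReal_sub_I_ne_zero x) (ofReal_sub_I_ne_zero y)] at h
  have h2 : 2 * Complex.I * ((y : ℂ) - x) = 0 := by linear_combination h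
  simpa [sub_eq_zero, eq_comm] using h2

theorem exists_norm_eq_one_forall_add_I_pow_ne {K : Set ℂ} (hK : IsCompact K)
    (hint : interior {x : ℝ | (x : ℂ) ∈ K} = ∅) {n : ℕ} (hn : n ≠ 0) :
    ∃ c : ℂ, ‖c‖ = 1 ∧ ∀ w ∈ K, (w + Complex.I) ^ n - c * (w - Complex.I) ^ n ≠ 0 := by
  have hS : IsCompact {x : ℝ | (x : ℂ) ∈ K} :=
    Complex.isometry_ofReal.isClosedEmbedding.isCompact_preimage hK
  have hroots : {ζ : Circle | ζ ^ n = 1}.Countable := by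
    refine Set.Finite.countable (Set.Finite.of_finite_image (f := ((↑) : Circle → ℂ)) ?_
      Circle.coe_injective.injOn)
    refine (Polynomial.nthRootsFinset n (1 : ℂ)).finite_toSet.subset ?_
    rintro _ ⟨ζ, hζ, rfl⟩
    simp only [Finset.mem_coe, Polynomial.mem_nthRootsFinset (Nat.pos_of_ne_zero hn)]
    exact_mod_cast congrArg ((↑) : Circle → ℂ) hζ
  obtain ⟨g, hg⟩ := exists_forall_mul_notMem (hS.image continuous_cayley).isClosed
    (interior_image_eq_empty continuous_cayley injective_cayley hint) hroots
  refine ⟨(g ^ n : Circle), Circle.norm_coe _, fun w hw h => ?_⟩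
  have hpow := sub_eq_zero.1 h
  have hnorm : ‖w + Complex.I‖ = ‖w - Complex.I‖ := by
    have := congrArg norm hpow
    rw [norm_mul, Circle.norm_coe, one_mul, norm_pow, norm_pow] at this
    exact (pow_left_inj₀ (norm_nonneg _) (norm_nonneg _) hn).1 this
  have him : w.im = 0 := by
    have := normSq_add_I_sub_normSq_sub_I w
    rw [hnorm] at this
    linarith
  have hre : (w.re : ℂ) = w := Complex.ext rfl (by simp [him])
  refine hg (cayley w.re * g⁻¹) ?_ (by simpa using! ⟨w.re, by simpa [hre] using hw, rfl⟩)
  have h0 : w - Complex.I ≠ 0 := hre ▸ ofReal_sub_I_ne_zero w.re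
  rw [Set.mem_ofPred_eq, mul_pow, inv_pow, mul_inv_eq_one, ← Circle.coe_inj, Circle.coe_pow,
    coe_cayley, hre, div_pow, div_eq_iff (pow_ne_zero n h0), hpow]

theorem norm_mul_pow_div_sub_le {u v c : ℂ} (huv : ‖v‖ < ‖u‖) (hc : ‖c‖ = 1) {n : ℕ}
    (hn : n ≠ 0) :
    ‖c * v ^ n / (u ^ n - c * v ^ n)‖ ≤ (‖v‖ / ‖u‖) ^ n * (1 - ‖v‖ / ‖u‖)⁻¹ := by
  have hu : 0 < ‖u‖ := (norm_nonneg v).trans_lt huv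
  have hs : ‖v‖ / ‖u‖ < 1 := (div_lt_one hu).2 huv
  have hden : ‖u‖ ^ n * (1 - ‖v‖ / ‖u‖) ≤ ‖u ^ n - c * v ^ n‖ := by
    calc ‖u‖ ^ n * (1 - ‖v‖ / ‖u‖) ≤ ‖u‖ ^ n * (1 - (‖v‖ / ‖u‖) ^ n) := by
          gcongr
          exact pow_le_of_le_one (by positivity) hs.le hn
      _ = ‖u ^ n‖ - ‖c * v ^ n‖ := by
          rw [norm_mul, hc, one_mul, norm_pow, norm_pow, mul_sub, mul_one, ← mul_pow,
            mul_div_cancel₀ _ hu.ne']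
      _ ≤ ‖u ^ n - c * v ^ n‖ := norm_sub_norm_le _ _
  rw [norm_div, norm_mul, hc, one_mul, norm_pow, div_pow, ← div_eq_mul_inv, div_div]
  have := sub_pos.2 hs
  gcongr

/-- The rational functions `(w + i)ⁿ / ((w + i)ⁿ - c (w - i)ⁿ)`, which for `|c| = 1` tend to `1` on
the upper and to `0` on the lower half plane as `n → ∞`. -/
noncomputable def splitting (n : ℕ) (c w : ℂ) : ℂ :=
  (w + Complex.I) ^ n / ((w + Complex.I) ^ n - c * (w - Complex.I) ^ n)

theorem splitting_mem_Rat {K : Set ℂ} {n : ℕ} {c : ℂ}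
    (hc : ∀ w ∈ K, (w + Complex.I) ^ n - c * (w - Complex.I) ^ n ≠ 0) :
    splitting n c ∈ Rat K := by
  refine ⟨(Polynomial.X + Polynomial.C Complex.I) ^ n,
    (Polynomial.X + Polynomial.C Complex.I) ^ n -
      Polynomial.C c * (Polynomial.X - Polynomial.C Complex.I) ^ n, ?_, ?_⟩
  · simpa using hc
  · ext w
    simp [splitting]

theorem inv_one_sub_norm_div_norm_le {u v : ℂ} (huv : ‖v‖ < ‖u‖) :
    (1 - ‖v‖ / ‖u‖)⁻¹ ≤ 2 * ‖u‖ ^ 2 / (‖u‖ ^ 2 - ‖v‖ ^ 2) := by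
  have hu : 0 < ‖u‖ := (norm_nonneg v).trans_lt huv
  have hsub : 0 < ‖u‖ - ‖v‖ := sub_pos.2 huv
  rw [one_sub_div hu.ne', inv_div, sq_sub_sq, div_le_div_iff₀ hsub (by positivity)]
  calc ‖u‖ * ((‖u‖ + ‖v‖) * (‖u‖ - ‖v‖)) ≤ ‖u‖ * ((‖u‖ + ‖u‖) * (‖u‖ - ‖v‖)) := by gcongr
    _ = 2 * ‖u‖ ^ 2 * (‖u‖ - ‖v‖) := by ring

theorem pow_sub_mul_pow_ne_zero {u v c : ℂ} (huv : ‖v‖ < ‖u‖) (hc : ‖c‖ = 1) {n : ℕ}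
    (hn : n ≠ 0) : u ^ n - c * v ^ n ≠ 0 := fun h => by
  have hnorm := congrArg norm (sub_eq_zero.1 h)
  rw [norm_mul, hc, one_mul, norm_pow, norm_pow] at hnorm
  exact (pow_lt_pow_left₀ huv (norm_nonneg v) hn).ne' hnorm

theorem norm_splitting_sub_one_le {w c : ℂ} (hw : ‖w - Complex.I‖ < ‖w + Complex.I‖)
    (hc : ‖c‖ = 1) {n : ℕ} (hn : n ≠ 0) :
    ‖splitting n c w - 1‖ ≤ (‖w - Complex.I‖ / ‖w + Complex.I‖) ^ n *
      (1 - ‖w - Complex.I‖ / ‖w + Complex.I‖)⁻¹ := by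
  rw [splitting, div_sub_one (pow_sub_mul_pow_ne_zero hw hc hn), sub_sub_cancel]
  exact norm_mul_pow_div_sub_le hw hc hn

theorem norm_splitting_le {w c : ℂ} (hw : ‖w + Complex.I‖ < ‖w - Complex.I‖)
    (hc : ‖c‖ = 1) {n : ℕ} (hn : n ≠ 0) :
    ‖splitting n c w‖ ≤ (‖w + Complex.I‖ / ‖w - Complex.I‖) ^ n *
      (1 - ‖w + Complex.I‖ / ‖w - Complex.I‖)⁻¹ := by
  have hc0 : c ≠ 0 := norm_ne_zero_iff.1 (by simp [hc])
  have hsplit : splitting n c w = -(c⁻¹ * (w + Complex.I) ^ n /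
      ((w - Complex.I) ^ n - c⁻¹ * (w + Complex.I) ^ n)) := by
    rw [splitting, ← mul_div_mul_left _ ((w + Complex.I) ^ n - _) (inv_ne_zero hc0), mul_sub,
      inv_mul_cancel_left₀ hc0, ← div_neg, neg_sub]
  rw [hsplit, norm_neg]
  exact norm_mul_pow_div_sub_le hw (by rw [norm_inv, hc, inv_one]) hn

theorem exists_norm_splitting_sub_indicator_le {w : ℂ} (hw : w.im ≠ 0) :
    ∃ s ∈ Set.Ico (0 : ℝ) 1, (1 - s)⁻¹ ≤ (‖w‖ + 1) ^ 2 / 2 * |w.im|⁻¹ ∧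
      ∀ n : ℕ, n ≠ 0 → ∀ c : ℂ, ‖c‖ = 1 →
        ‖splitting n c w - upperHalfPlaneSet.indicator 1 w‖ ≤ s ^ n * (1 - s)⁻¹ := by
  have hsq := normSq_add_I_sub_normSq_sub_I w
  have hconst : ∀ {u v : ℂ}, ‖v‖ < ‖u‖ → ‖u‖ ≤ ‖w‖ + 1 → ‖u‖ ^ 2 - ‖v‖ ^ 2 = 4 * |w.im| →
      (1 - ‖v‖ / ‖u‖)⁻¹ ≤ (‖w‖ + 1) ^ 2 / 2 * |w.im|⁻¹ := fun {u v} hvu hu hdiff =>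
    calc (1 - ‖v‖ / ‖u‖)⁻¹ ≤ 2 * ‖u‖ ^ 2 / (4 * |w.im|) :=
          hdiff ▸ inv_one_sub_norm_div_norm_le hvu
      _ ≤ 2 * (‖w‖ + 1) ^ 2 / (4 * |w.im|) := by gcongr
      _ = (‖w‖ + 1) ^ 2 / 2 * |w.im|⁻¹ := by ring
  have hmem : ∀ {u v : ℂ}, ‖v‖ < ‖u‖ → ‖v‖ / ‖u‖ ∈ Set.Ico (0 : ℝ) 1 := fun hvu =>
    ⟨by positivity, (div_lt_one ((norm_nonneg _).trans_lt hvu)).2 hvu⟩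
  rcases hw.lt_or_gt with hneg | hpos
  · have huv : ‖w + Complex.I‖ < ‖w - Complex.I‖ :=
      lt_of_pow_lt_pow_left₀ 2 (norm_nonneg _) (by linarith)
    refine ⟨_, hmem huv, hconst huv (by simpa using norm_sub_le w Complex.I) ?_, ?_⟩
    · rw [abs_of_neg hneg]
      linarith
    · intro n hn c hc
      simpa [hneg.not_gt] using norm_splitting_le huv hc hn
  · have hvu : ‖w - Complex.I‖ < ‖w + Complex.I‖ :=
      lt_of_pow_lt_pow_left₀ 2 (norm_nonneg _) (by linarith)
    refine ⟨_, hmem hvu, hconst hvu (by simpa using norm_add_le w Complex.I) ?_, ?_⟩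
    · rwa [abs_of_pos hpos]
    · intro n hn c hc
      simpa [hpos] using norm_splitting_sub_one_le hvu hc hn

theorem memR_indicator_upperHalfPlaneSet {K : Set ℂ} {t : ℝ≥0∞} [Fact (1 ≤ t)] (ht : t ≠ ∞)
    {μ : Measure ℂ} [IsFiniteMeasure μ] (hK : IsCompact K)
    (hint : interior {x : ℝ | (x : ℂ) ∈ K} = ∅) (hμ : ∀ᵐ z ∂μ, z ∈ K)
    (him : ∀ᵐ z ∂μ, z.im ≠ 0) (hinv : MemLp (fun z : ℂ => z.im⁻¹) t μ) :
    MemR K t μ (upperHalfPlaneSet.indicator 1) := by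
  obtain ⟨M, hM⟩ := hK.isBounded.exists_norm_le
  choose c hc hne using fun n : ℕ =>
    exists_norm_eq_one_forall_add_I_pow_ne hK hint n.succ_ne_zero
  have hRat : ∀ n, splitting (n + 1) (c n) ∈ Rat K := fun n => splitting_mem_Rat (hne n)
  have hχ : Measurable (upperHalfPlaneSet.indicator (1 : ℂ → ℂ)) :=
    measurable_one.indicator UpperHalfPlane.isOpen_upperHalfPlaneSet.measurableSet
  refine .of_tendsto (fun n => .of_mem_Rat (hRat n) (memLp_of_mem_Rat hK hμ (hRat n)))
    (.of_bound hχ.aestronglyMeasurable 1 (.of_forall fun z => ?_)) ?_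
  · simpa using norm_indicator_le_norm_self (1 : ℂ → ℂ) z
  refine tendsto_eLpNorm_of_dominated ht
    (fun n => (measurable_of_mem_Rat (hRat n)).aestronglyMeasurable) hχ.aestronglyMeasurable
    (hinv.norm.const_mul ((M + 1) ^ 2 / 2)) (fun n => ?_) ?_
  · filter_upwards [hμ, him] with z hzK hz
    obtain ⟨s, hs, hsz, hsplit⟩ := exists_norm_splitting_sub_indicator_le hz
    calc ‖splitting (n + 1) (c n) z - upperHalfPlaneSet.indicator 1 z‖
        ≤ s ^ (n + 1) * (1 - s)⁻¹ := hsplit _ n.succ_ne_zero _ (hc n)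
      _ ≤ 1 * (1 - s)⁻¹ := by
          have := sub_pos.2 hs.2
          gcongr
          exact pow_le_one₀ hs.1 hs.2.le
      _ ≤ (‖z‖ + 1) ^ 2 / 2 * |z.im|⁻¹ := by rwa [one_mul]
      _ ≤ (M + 1) ^ 2 / 2 * ‖z.im⁻¹‖ := by
          rw [norm_inv, Real.norm_eq_abs]
          gcongr
          exact hM z hzK
  · filter_upwards [him] with z hz
    obtain ⟨s, hs, -, hsplit⟩ := exists_norm_splitting_sub_indicator_le hz
    refine tendsto_iff_norm_sub_tendsto_zero.2 (squeeze_zero (fun _ => norm_nonneg _)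
      (fun n => hsplit _ n.succ_ne_zero _ (hc n)) ?_)
    simpa using (((tendsto_pow_atTop_nhds_zero_of_lt_one hs.1 hs.2).comp
      (Filter.tendsto_add_atTop_nat 1)).mul_const (1 - s)⁻¹)

theorem memR_indicator_OmU {K : Set ℂ} {t : ℝ≥0∞} [Fact (1 ≤ t)] (ht : t ≤ 4)
    (hK : IsCompact K) (hint : interior {x : ℝ | (x : ℂ) ∈ K} = ∅) :
    MemR K t (areaW K) ((OmU K).indicator fun _ => 1) := by
  have := isFiniteMeasure_areaW hK
  refine (memR_indicator_upperHalfPlaneSet (ht.trans_lt (by norm_num)).ne hK hint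
    (ae_mem_of_areaW K) ((ae_mem_Om K).mono fun z hz => im_ne_zero_of_mem_Om hint hz)
    ((memLp_inv_im hK).mono_exponent ht)).congr ?_
  filter_upwards [ae_mem_Om K] with z hz
  by_cases hzim : 0 < z.im <;> simp [OmU, hz, hzim]

theorem memR_indicator_OmL {K : Set ℂ} {t : ℝ≥0∞} [Fact (1 ≤ t)] (ht : t ≤ 4)
    (hK : IsCompact K) (hint : interior {x : ℝ | (x : ℂ) ∈ K} = ∅) :
    MemR K t (areaW K) ((OmL K).indicator fun _ => 1) := by
  have := isFiniteMeasure_areaW hK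
  have hone : (fun z => (1 : Polynomial ℂ).eval z) ∈ Rat K := eval_mem_Rat K 1
  refine ((MemR.of_mem_Rat hone (memLp_of_mem_Rat hK (ae_mem_of_areaW K) hone)).sub
    (memR_indicator_OmU ht hK hint)).congr ?_
  filter_upwards [ae_mem_Om K] with z hz
  by_cases hzU : z ∈ OmU K <;> simp [OmL, hz, hzU]

end SplittingFunction

section UniformApproximation

/-- On `U`, the function `φ` is a uniform limit of members of `Rat(K)`. -/
def IsRatApproximableOn (K U : Set ℂ) (φ : ℂ → ℂ) : Prop :=
  ∀ ε : ℝ, 0 < ε → ∃ m ∈ Rat K, ∀ z ∈ U, ‖m z - φ z‖ ≤ ε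

variable {K U : Set ℂ} {a : ℂ}

theorem IsRatApproximableOn.inv_sub_of_mem_closure_compl (haU : a ∉ closure U)
    (haK : a ∈ closure Kᶜ) : IsRatApproximableOn K U fun z => (z - a)⁻¹ := by
  intro ε hε
  obtain ⟨d, hd, hdU⟩ : ∃ d > 0, ∀ z ∈ U, d ≤ ‖z - a‖ := by
    simpa [Metric.mem_closure_iff, dist_eq_norm, norm_sub_rev a] using haU
  obtain ⟨b, hb, hab⟩ := Metric.mem_closure_iff.1 haK (min (d / 2) (ε * (d / 2 * d)))
    (by positivity)
  refine ⟨_, inv_sub_mem_Rat hb, fun z hz => ?_⟩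
  rw [dist_comm, dist_eq_norm, lt_min_iff] at hab
  have hza : d ≤ ‖z - a‖ := hdU z hz
  have hzb : d / 2 ≤ ‖z - b‖ := by
    have := norm_sub_norm_le (z - a) (b - a)
    rw [sub_sub_sub_cancel_right] at this
    linarith [hab.1]
  have hza0 : z - a ≠ 0 := norm_pos_iff.1 (hd.trans_le hza)
  have hzb0 : z - b ≠ 0 := norm_pos_iff.1 ((half_pos hd).trans_le hzb)
  calc ‖(z - b)⁻¹ - (z - a)⁻¹‖ = ‖b - a‖ / (‖z - b‖ * ‖z - a‖) := by
        rw [inv_sub_inv hzb0 hza0, sub_sub_sub_cancel_left, norm_div, norm_mul]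
    _ ≤ ε * (d / 2 * d) / (d / 2 * d) := by
        gcongr
        exact hab.2.le
    _ = ε := mul_div_cancel_right₀ ε (by positivity)

theorem IsRatApproximableOn.inv_sub_of_subset_closedBall (K : Set ℂ) {b : ℂ} {ρ : ℝ}
    (hU : U ⊆ Metric.closedBall b ρ) (ha : ρ < ‖a - b‖) :
    IsRatApproximableOn K U fun z => (z - a)⁻¹ := by
  rcases U.eq_empty_or_nonempty with rfl | ⟨z₀, hz₀⟩
  · exact fun ε _ => ⟨_, eval_mem_Rat K 0, by simp⟩
  have hρ : 0 ≤ ρ := Metric.nonempty_closedBall.1 ⟨z₀, hU hz₀⟩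
  have hab : 0 < ‖a - b‖ := hρ.trans_lt ha
  have hab0 : a - b ≠ 0 := norm_pos_iff.1 hab
  have hs : ρ / ‖a - b‖ < 1 := (div_lt_one hab).2 ha
  have hratio : ∀ z ∈ U, ‖(z - b) / (a - b)‖ ≤ ρ / ‖a - b‖ := fun z hz => by
    rw [norm_div, ← dist_eq_norm z]
    gcongr
    exact hU hz
  have hunif := tendstoUniformlyOn_tsum_nat
    (f := fun n z => -(a - b)⁻¹ * ((z - b) / (a - b)) ^ n) (s := U)
    ((summable_geometric_of_lt_one (by positivity) hs).mul_left ‖(a - b)⁻¹‖) fun n z hz => by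
      rw [norm_mul, norm_neg, norm_pow]
      gcongr
      exact hratio z hz
  intro ε hε
  obtain ⟨N, hN⟩ := (Metric.tendstoUniformlyOn_iff.1 hunif ε hε).exists
  refine ⟨_, eval_mem_Rat K (∑ n ∈ Finset.range N, Polynomial.C (-(a - b)⁻¹) *
    ((Polynomial.X - Polynomial.C b) * Polynomial.C (a - b)⁻¹) ^ n), fun z hz => ?_⟩
  have hsum : ∑' n : ℕ, -(a - b)⁻¹ * ((z - b) / (a - b)) ^ n = (z - a)⁻¹ := by
    rw [tsum_mul_left, tsum_geometric_of_norm_lt_one ((hratio z hz).trans_lt hs),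
      one_sub_div hab0, sub_sub_sub_cancel_right, inv_div, ← neg_sub z a, div_neg]
    field_simp
  have hNz := (hN z hz).le
  rw [hsum, dist_comm, dist_eq_norm] at hNz
  simpa [Polynomial.eval_finsetSum, div_eq_mul_inv] using hNz

-- A large disk centred far out on the imaginary axis covers `U` but not the point `a`.
theorem IsRatApproximableOn.inv_sub_of_opposite_sides (K : Set ℂ) (hUb : Bornology.IsBounded U)
    {σ : ℝ} (hU : ∀ z ∈ U, 0 ≤ σ * z.im) (ha : σ * a.im < 0) :
    IsRatApproximableOn K U fun z => (z - a)⁻¹ := by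
  obtain ⟨M, hM⟩ := hUb.exists_norm_le
  obtain ⟨T, hT0, hT⟩ : ∃ T : ℝ, 0 ≤ T ∧ M ^ 2 < 2 * T * -(σ * a.im) := by
    refine ⟨(M ^ 2 + 1) / -(σ * a.im), div_nonneg (by positivity) (by linarith), ?_⟩
    rw [mul_assoc, div_mul_cancel₀ _ (by linarith)]
    nlinarith
  have hsq : ∀ z : ℂ, ‖z - (σ * T : ℝ) * Complex.I‖ ^ 2 =
      ‖z‖ ^ 2 - 2 * T * (σ * z.im) + (σ * T) ^ 2 := fun z => by
    rw [← Complex.normSq_eq_norm_sq, ← Complex.normSq_eq_norm_sq, Complex.normSq_apply,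
      Complex.normSq_apply]
    simp only [Complex.sub_re, Complex.sub_im, Complex.re_ofReal_mul, Complex.im_ofReal_mul,
      Complex.I_re, Complex.I_im]
    ring
  refine .inv_sub_of_subset_closedBall K (b := (σ * T : ℝ) * Complex.I)
    (ρ := √(M ^ 2 + (σ * T) ^ 2)) (fun z hz => ?_) ?_
  · rw [mem_closedBall_iff_norm]
    refine Real.le_sqrt_of_sq_le ?_
    rw [hsq]
    have hz0 := mul_nonneg (mul_nonneg zero_le_two hT0) (hU z hz)
    have hzM := pow_le_pow_left₀ (norm_nonneg z) (hM z hz) 2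
    linarith
  · rw [← Real.sqrt_sq (norm_nonneg _), hsq]
    exact Real.sqrt_lt_sqrt (by positivity) (by nlinarith [sq_nonneg ‖a‖])

theorem isRatApproximableOn_OmU (hK : Bornology.IsBounded K) (him : ∀ z ∈ Om K, z.im ≠ 0)
    (ha : a ∉ KU K) : IsRatApproximableOn K (OmU K) fun z => (z - a)⁻¹ := by
  by_cases haK : a ∈ Om K
  · have haL : a ∈ OmL K := ⟨haK, fun h => ha (subset_closure h)⟩
    rw [OmL_eq him] at haL
    exact .inv_sub_of_opposite_sides K (hK.subset fun z hz => interior_subset hz.1) (σ := 1)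
      (fun z hz => by simpa using hz.2.le) (by simpa using haL.2)
  · exact .inv_sub_of_mem_closure_compl ha (by rwa [closure_compl])

theorem isRatApproximableOn_OmL (hK : Bornology.IsBounded K) (him : ∀ z ∈ Om K, z.im ≠ 0)
    (ha : a ∉ KL K) : IsRatApproximableOn K (OmL K) fun z => (z - a)⁻¹ := by
  by_cases haK : a ∈ Om K
  · have haU : a ∈ OmU K := by_contra fun h => ha (subset_closure ⟨haK, h⟩)
    refine .inv_sub_of_opposite_sides K (hK.subset fun z hz => interior_subset hz.1) (σ := -1)
      (fun z hz => ?_) (by simpa using haU.2)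
    rw [OmL_eq him] at hz
    simpa using hz.2.le
  · exact .inv_sub_of_mem_closure_compl ha (by rwa [closure_compl])

variable {t : ℝ≥0∞} [Fact (1 ≤ t)] {μ : Measure ℂ}

theorem MemR.indicator_mul (hK : IsCompact K) (hμ : ∀ᵐ z ∂μ, z ∈ K) {φ f : ℂ → ℂ}
    (hφm : Measurable φ) (hφ : IsRatApproximableOn K U φ) (hf : MemR K t μ (U.indicator f)) :
    MemR K t μ (U.indicator fun z => φ z * f z) := by
  rw [show (U.indicator fun z => φ z * f z) = fun z => φ z * U.indicator f z by
    ext z; by_cases hz : z ∈ U <;> simp [hz]]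
  choose m hm hmU using fun n : ℕ => hφ (1 / (n + 1)) (by positivity)
  have hu : ∀ n, MemR K t μ fun z => m n z * U.indicator f z := fun n => hf.rat_mul hK hμ (hm n)
  have hbound : ∀ (n : ℕ) z, ‖m n z * U.indicator f z - φ z * U.indicator f z‖ ≤
      1 / (n + 1) * ‖U.indicator f z‖ := fun n z => by
    by_cases hz : z ∈ U
    · rw [← sub_mul, norm_mul]
      gcongr
      exact hmU n z hz
    · simp [hz]
  have hLp : MemLp (fun z => φ z * U.indicator f z) t μ := by
    have hφf := hφm.aestronglyMeasurable.mul hf.memLp.1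
    have hdiff : MemLp ((fun z => m 0 z * U.indicator f z) - fun z => φ z * U.indicator f z) t μ :=
      hf.memLp.of_le_mul ((hu 0).memLp.1.sub hφf) (.of_forall (hbound 0))
    simpa using (hu 0).memLp.sub hdiff
  refine .of_tendsto hu hLp ?_
  refine tendsto_of_tendsto_of_tendsto_of_le_of_le tendsto_const_nhds ?_ (fun _ => zero_le)
    fun n => eLpNorm_le_mul_eLpNorm_of_ae_le_mul (.of_forall (hbound n)) t
  simpa using ENNReal.Tendsto.mul_const
    (ENNReal.tendsto_ofReal (tendsto_one_div_add_atTop_nhds_zero_nat (𝕜 := ℝ)))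
    (Or.inr hf.memLp.2.ne)

theorem MemR.indicator_of_mem_Rat_closure (hK : IsCompact K) (hμ : ∀ᵐ z ∂μ, z ∈ K)
    (hU : MemR K t μ (U.indicator fun _ => 1))
    (hpole : ∀ a ∉ closure U, IsRatApproximableOn K U fun z => (z - a)⁻¹) {f : ℂ → ℂ}
    (hf : f ∈ Rat (closure U)) : MemR K t μ (U.indicator f) := by
  obtain ⟨p, s, hs, rfl⟩ := exists_eq_eval_mul_prod_inv_sub hf
  have hprod : MemR K t μ (U.indicator fun z => (s.map fun a => (z - a)⁻¹).prod) := by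
    clear hf
    induction s using Multiset.induction_on with
    | empty => simpa using hU
    | cons a s ih =>
      simp only [Multiset.mem_cons, forall_eq_or_imp] at hs
      simpa using (ih hs.2).indicator_mul hK hμ (by fun_prop) (hpole a hs.1)
  refine (hprod.rat_mul hK hμ (eval_mem_Rat K p)).congr (.of_forall fun z => ?_)
  by_cases hz : z ∈ U <;> simp [hz]

end UniformApproximation

section ExtendByZero

variable {K V U U' : Set ℂ} {t : ℝ≥0∞} [Fact (1 ≤ t)] {μ : Measure ℂ}

theorem mem_extendByZero (hU : MeasurableSet U) {N : Submodule ℂ (Lp ℂ t (μ.restrict U))}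
    {F : Lp ℂ t μ} : F ∈ extendByZero U N ↔
      LpToLpRestrictCLM ℂ ℂ ℂ μ t U F ∈ N ∧ ∀ᵐ z ∂μ, z ∉ U → F z = 0 := by
  have hker : LpToLpRestrictCLM ℂ ℂ ℂ μ t Uᶜ F = 0 ↔ ∀ᵐ z ∂μ, z ∉ U → F z = 0 := by
    rw [Lp.eq_zero_iff_ae_eq_zero, (LpToLpRestrictCLM_coeFn ℂ Uᶜ F).congr_left]
    exact ae_restrict_iff' hU.compl
  simp only [extendByZero, Submodule.mem_inf, Submodule.mem_comap, LinearMap.mem_ker,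
    ContinuousLinearMap.coe_coe, hker]

theorem MemR.indicator_of_restrict (hU : MeasurableSet U) (hV : ∀ᵐ z ∂μ.restrict U, z ∈ V)
    (h : ∀ f ∈ Rat V, MemLp f t (μ.restrict U) → MemR K t μ (U.indicator f)) {f : ℂ → ℂ}
    (hf : MemR V t (μ.restrict U) f) : MemR K t μ (U.indicator f) := by
  obtain ⟨u, hu, hlim⟩ := hf.exists_seq_tendsto hV
  refine .of_tendsto (fun n => h _ (hu n).1 (hu n).2) ((memLp_indicator_iff_restrict hU).2 hf.memLp)
    (hlim.congr fun n => ?_)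
  rw [← Set.indicator_sub', eLpNorm_indicator_eq_eLpNorm_restrict hU]

theorem extendByZero_R_le (hU : MeasurableSet U) (hV : ∀ᵐ z ∂μ.restrict U, z ∈ V)
    (h : ∀ f ∈ Rat V, MemLp f t (μ.restrict U) → MemR K t μ (U.indicator f)) :
    extendByZero U (R V t (μ.restrict U)) ≤ R K t μ := by
  intro F hF
  obtain ⟨hFU, hF0⟩ := (mem_extendByZero hU).1 hF
  refine memR_coe_iff.1 (((memR_coe_iff.2 hFU).indicator_of_restrict hU hV h).congr ?_)
  filter_upwards [(ae_restrict_iff' hU).1 (LpToLpRestrictCLM_coeFn (p := t) ℂ U F), hF0]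
    with z hz hz0
  by_cases hzU : z ∈ U
  · rw [Set.indicator_of_mem hzU, hz hzU]
  · rw [Set.indicator_of_notMem hzU, hz0 hzU]

theorem toLp_indicator_mem_extendByZero (hU : MeasurableSet U) (hVK : V ⊆ K)
    (hμ : ∀ᵐ z ∂μ, z ∈ K) {F : Lp ℂ t μ} (hF : F ∈ R K t μ) :
    ((Lp.memLp F).indicator hU).toLp _ ∈ extendByZero U (R V t (μ.restrict U)) := by
  have hcoe := ((Lp.memLp F).indicator hU).coeFn_toLp
  refine (mem_extendByZero hU).2 ⟨memR_coe_iff.1 ?_, hcoe.mono fun z hz hzU => ?_⟩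
  · refine ((memR_coe_iff.2 hF).mono_measure hVK Measure.restrict_le_self hμ).congr ?_
    refine .trans ?_ (LpToLpRestrictCLM_coeFn ℂ U _).symm
    filter_upwards [ae_restrict_of_ae hcoe, ae_restrict_mem hU] with z hz hzU
    rw [hz, Set.indicator_of_mem hzU]
  · rw [hz, Set.indicator_of_notMem hzU]

theorem R_le_sup_extendByZero {V' : Set ℂ} (hU : MeasurableSet U) (hU' : MeasurableSet U')
    (hUU' : Disjoint U U') (hμU : ∀ᵐ z ∂μ, z ∈ U ∪ U') (hμ : ∀ᵐ z ∂μ, z ∈ K) (hVK : V ⊆ K)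
    (hVK' : V' ⊆ K) :
    R K t μ ≤ extendByZero U (R V t (μ.restrict U)) ⊔ extendByZero U' (R V' t (μ.restrict U')) := by
  intro F hF
  refine Submodule.mem_sup.2 ⟨_, toLp_indicator_mem_extendByZero hU hVK hμ hF,
    _, toLp_indicator_mem_extendByZero hU' hVK' hμ hF, Lp.ext ((Lp.coeFn_add _ _).trans ?_)⟩
  filter_upwards [((Lp.memLp F).indicator hU).coeFn_toLp,
    ((Lp.memLp F).indicator hU').coeFn_toLp, hμU] with z hz hz' hzU
  rw [Pi.add_apply, hz, hz', ← Set.indicator_of_mem hzU F]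
  exact (congrFun (Set.indicator_union_of_disjoint hUU' F) z).symm

theorem extendByZero_isOrtho (hU : MeasurableSet U) (hU' : MeasurableSet U')
    (hUU' : Disjoint U U') (N : Submodule ℂ (Lp ℂ 2 (μ.restrict U)))
    (N' : Submodule ℂ (Lp ℂ 2 (μ.restrict U'))) : extendByZero U N ⟂ extendByZero U' N' := by
  rw [Submodule.isOrtho_iff_inner_eq]
  intro F hF G hG
  rw [L2.inner_def]
  refine integral_eq_zero_of_ae ?_
  filter_upwards [((mem_extendByZero hU).1 hF).2, ((mem_extendByZero hU').1 hG).2] with z hzF hzG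
  by_cases hz : z ∈ U
  · simp [hzG (Set.disjoint_left.1 hUU' hz)]
  · simp [hzF hz]

theorem KU_subset (hK : IsClosed K) : KU K ⊆ K :=
  closure_minimal (fun _ hz => interior_subset hz.1) hK

theorem KL_subset (hK : IsClosed K) : KL K ⊆ K :=
  closure_minimal (fun _ hz => interior_subset hz.1) hK

theorem R_areaW_eq_sup (ht : t ≤ 4) (hK : IsCompact K)
    (hint : interior {x : ℝ | (x : ℂ) ∈ K} = ∅) :
    R K t (areaW K) =
      extendByZero (OmU K) (R (KU K) t ((areaW K).restrict (OmU K))) ⊔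
        extendByZero (OmL K) (R (KL K) t ((areaW K).restrict (OmL K))) := by
  have him : ∀ z ∈ Om K, z.im ≠ 0 := fun z hz => im_ne_zero_of_mem_Om hint hz
  have hU := (isOpen_OmU K).measurableSet
  have hL := (isOpen_OmL him).measurableSet
  have hμ := ae_mem_of_areaW K
  apply le_antisymm
  · refine R_le_sup_extendByZero hU hL Set.disjoint_sdiff_right ?_ hμ (KU_subset hK.isClosed)
      (KL_subset hK.isClosed)
    exact (ae_mem_Om K).mono fun z hz => (em (z ∈ OmU K)).imp_right fun h => ⟨hz, h⟩
  · refine sup_le (extendByZero_R_le hU ?_ fun f hf _ => ?_)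
      (extendByZero_R_le hL ?_ fun f hf _ => ?_)
    · exact (ae_restrict_mem hU).mono fun z hz => subset_closure hz
    · exact (memR_indicator_OmU ht hK hint).indicator_of_mem_Rat_closure hK hμ
        (fun a ha => isRatApproximableOn_OmU hK.isBounded him ha) hf
    · exact (ae_restrict_mem hL).mono fun z hz => subset_closure hz
    · exact (memR_indicator_OmL ht hK hint).indicator_of_mem_Rat_closure hK hμ
        (fun a ha => isRatApproximableOn_OmL hK.isBounded him ha) hf

end ExtendByZero

section AreaMeanValue

open Real (pi_pos)

theorem lintegral_eq_lintegral_circleMap {g : ℂ → ℝ≥0∞} (hg : Measurable g) (c : ℂ) :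
    ∫⁻ z, g z = ∫⁻ r in Set.Ioi 0, .ofReal r *
      ∫⁻ θ in Set.Ioo (-Real.pi) Real.pi, g (circleMap c r θ) := by
  have hpolar : ∀ p : ℝ × ℝ, c + Complex.polarCoord.symm p = circleMap c p.1 p.2 := fun p => by
    rw [Complex.polarCoord_symm_apply, circleMap, Complex.exp_mul_I]
    push_cast
    rfl
  have hmeas : Measurable fun p : ℝ × ℝ => .ofReal p.1 * g (circleMap c p.1 p.2) :=
    measurable_fst.ennreal_ofReal.mul (hg.comp (by unfold circleMap; fun_prop))
  calc ∫⁻ z, g z = ∫⁻ z, g (c + z) := (lintegral_add_left_eq_self g c).symm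
    _ = ∫⁻ p in polarCoord.target, .ofReal p.1 * g (circleMap c p.1 p.2) := by
        simp only [← Complex.lintegral_comp_polarCoord_symm fun z => g (c + z), smul_eq_mul, hpolar]
    _ = _ := by
        rw [polarCoord_target, Measure.volume_eq_prod, setLIntegral_prod _ hmeas.aemeasurable]
        congr with r
        exact lintegral_const_mul (ENNReal.ofReal r) (hg.comp (continuous_circleMap c r).measurable)

variable {E : Type*} [NormedAddCommGroup E] [NormedSpace ℂ E] [CompleteSpace E]
  {f : ℂ → E} {c : ℂ} {ρ : ℝ}

theorem lintegral_enorm_center_le_circleMap (hρ : 0 ≤ ρ)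
    (hf : DiffContOnCl ℂ f (Metric.ball c ρ)) :
    ∫⁻ _ in Set.Ioo (-Real.pi) Real.pi, ‖f c‖ₑ ≤
      ∫⁻ θ in Set.Ioo (-Real.pi) Real.pi, ‖f (circleMap c ρ θ)‖ₑ := by
  have hmean : ∫ θ in Set.Ioo (-Real.pi) Real.pi, f (circleMap c ρ θ) = (2 * Real.pi) • f c := by
    have haverage : Real.circleAverage f c ρ = f c :=
      DiffContOnCl.circleAverage (by rwa [abs_of_nonneg hρ])
    rw [Real.circleAverage_eq_integral_add (-Real.pi),
      intervalIntegral.integral_comp_add_right (fun θ => f (circleMap c ρ θ)),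
      inv_smul_eq_iff₀ (by positivity)] at haverage
    rw [← haverage, ← integral_Ioc_eq_integral_Ioo,
      ← intervalIntegral.integral_of_le (by linarith [pi_pos])]
    ring_nf
  calc ∫⁻ _ in Set.Ioo (-Real.pi) Real.pi, ‖f c‖ₑ = ‖(2 * Real.pi) • f c‖ₑ := by
        rw [setLIntegral_const, Real.volume_Ioo, enorm_smul, Real.enorm_of_nonneg (by positivity),
          mul_comm]
        ring_nf
    _ ≤ _ := hmean ▸ enorm_integral_le_lintegral_enorm _

theorem enorm_mul_volume_ball_le (hf : DifferentiableOn ℂ f (Metric.ball c ρ)) :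
    ‖f c‖ₑ * volume (Metric.ball c ρ) ≤ ∫⁻ z in Metric.ball c ρ, ‖f z‖ₑ := by
  classical
  have hmeas : Measurable ((Metric.ball c ρ).indicator fun z => ‖f z‖ₑ) := by
    rw [← Set.piecewise_eq_indicator]
    exact hf.continuousOn.enorm.measurable_piecewise continuousOn_const measurableSet_ball
  rw [← setLIntegral_const, ← lintegral_indicator measurableSet_ball,
    ← lintegral_indicator measurableSet_ball,
    lintegral_eq_lintegral_circleMap (measurable_const.indicator measurableSet_ball) c,
    lintegral_eq_lintegral_circleMap hmeas c]
  refine setLIntegral_mono' measurableSet_Ioi fun r hr => ?_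
  have hmem : ∀ θ, circleMap c r θ ∈ Metric.ball c ρ ↔ r < ρ := fun θ => by
    rw [mem_ball_iff_norm, circleMap_sub_center, norm_circleMap_zero, abs_of_pos hr]
  by_cases hrρ : r < ρ
  · simp only [Set.indicator, hmem, hrρ, if_true]
    gcongr ENNReal.ofReal r * ?_
    refine lintegral_enorm_center_le_circleMap (le_of_lt hr) (hf.mono ?_).diffContOnCl
    exact Metric.closure_ball_subset_closedBall.trans (Metric.closedBall_subset_ball hrρ)
  · simp [Set.indicator, hmem, hrρ]

theorem exists_forall_enorm_le_mul_eLpNorm_ball (E : Type*) [NormedAddCommGroup E]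
    [NormedSpace ℂ E] [CompleteSpace E] {t : ℝ≥0∞} (ht : 1 ≤ t) (hρ : 0 < ρ) :
    ∃ M : ℝ≥0, ∀ (c : ℂ) (f : ℂ → E), DifferentiableOn ℂ f (Metric.ball c ρ) →
      ‖f c‖ₑ ≤ M * eLpNorm f t (volume.restrict (Metric.ball c ρ)) := by
  set v := volume (Metric.ball (0 : ℂ) ρ)
  have hv0 : v ≠ 0 := (Metric.measure_ball_pos volume _ hρ).ne'
  have hvtop : v ≠ ∞ := measure_ball_lt_top.ne
  have hM : v ^ (1 / (1 : ℝ≥0∞).toReal - 1 / t.toReal) / v ≠ ∞ :=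
    ENNReal.div_ne_top (ENNReal.rpow_ne_top_of_ne_zero hv0 hvtop) hv0
  refine ⟨(v ^ (1 / (1 : ℝ≥0∞).toReal - 1 / t.toReal) / v).toNNReal, fun c f hf => ?_⟩
  have hvc : volume (Metric.ball c ρ) = v := Measure.addHaar_ball_center volume c ρ
  have hHolder := eLpNorm_le_eLpNorm_mul_rpow_measure_univ ht
    (hf.continuousOn.aestronglyMeasurable measurableSet_ball (μ := volume))
  rw [eLpNorm_one_eq_lintegral_enorm, Measure.restrict_apply_univ, hvc] at hHolder
  rw [ENNReal.coe_toNNReal hM, mul_comm, ← mul_div_assoc, ENNReal.le_div_iff_mul_le (.inl hv0)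
    (.inl hvtop)]
  exact (hvc ▸ enorm_mul_volume_ball_le hf).trans hHolder

end AreaMeanValue

section PointEvaluations

variable {K : Set ℂ} {t : ℝ≥0∞}

theorem exists_restrict_le_smul_areaW (him : ∀ z ∈ Om K, z.im ≠ 0) {L : Set ℂ}
    (hL : IsCompact L) (hLK : L ⊆ Om K) :
    ∃ C : ℝ≥0, volume.restrict L ≤ (C : ℝ≥0∞) • areaW K := by
  have hne : ∀ z ∈ L, |z.im| ^ 4 ≠ 0 := fun z hz => pow_ne_zero 4 (abs_ne_zero.2 (him z (hLK hz)))
  obtain ⟨B, hB⟩ := hL.exists_bound_of_continuousOn (f := fun z : ℂ => (|z.im| ^ 4)⁻¹)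
    (ContinuousOn.inv₀ (by fun_prop) hne)
  have hone : ∀ z ∈ L, 1 ≤ (B.toNNReal : ℝ≥0∞) * ENNReal.ofReal (|z.im| ^ 4) := by
    intro z hz
    have hpos : 0 < |z.im| ^ 4 := (by positivity : 0 ≤ |z.im| ^ 4).lt_of_ne' (hne z hz)
    rw [ENNReal.ofNNReal_toNNReal, ← ENNReal.ofReal_mul' hpos.le, ENNReal.one_le_ofReal,
      ← div_le_iff₀ hpos, one_div]
    exact (le_abs_self _).trans (hB z hz)
  refine ⟨B.toNNReal, ?_⟩
  calc volume.restrict L = (volume.restrict L).withDensity 1 := withDensity_one.symm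
    _ ≤ (volume.restrict L).withDensity
          ((B.toNNReal : ℝ≥0∞) • fun z => ENNReal.ofReal (|z.im| ^ 4)) :=
        withDensity_mono ((ae_restrict_iff' hL.measurableSet).2 (.of_forall hone))
    _ = (B.toNNReal : ℝ≥0∞) • (areaW K).restrict L := by
        rw [withDensity_smul _ (by fun_prop), areaW_eq, restrict_withDensity hL.measurableSet,
          Measure.restrict_restrict_of_subset hLK]
    _ ≤ _ := by
        gcongr
        exact Measure.restrict_le_self

theorem exists_forall_eLpNorm_restrict_le_areaW (him : ∀ z ∈ Om K, z.im ≠ 0) (t : ℝ≥0∞)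
    {L : Set ℂ} (hL : IsCompact L) (hLK : L ⊆ Om K) :
    ∃ C : ℝ≥0, ∀ f : ℂ → ℂ, eLpNorm f t (volume.restrict L) ≤ C * eLpNorm f t (areaW K) := by
  obtain ⟨C, hC⟩ := exists_restrict_le_smul_areaW him hL hLK
  refine ⟨C ^ (1 / t).toReal, fun f => ?_⟩
  rw [ENNReal.coe_rpow_of_nonneg _ ENNReal.toReal_nonneg]
  exact eLpNorm_le_of_measure_le_smul hC

theorem exists_forall_ball_enorm_le_mul_eLpNorm_areaW (him : ∀ z ∈ Om K, z.im ≠ 0)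
    (ht : 1 ≤ t) {z₀ : ℂ} (hz₀ : z₀ ∈ Om K) :
    ∃ ρ > 0, ∃ M : ℝ≥0, ∀ z ∈ Metric.ball z₀ ρ, ∀ f : ℂ → ℂ, DifferentiableOn ℂ f (Om K) →
      ‖f z‖ₑ ≤ M * eLpNorm f t (areaW K) := by
  obtain ⟨δ, hδ, hδK⟩ := Metric.nhds_basis_closedBall.mem_iff.1 ((isOpen_Om K).mem_nhds hz₀)
  obtain ⟨C, hC⟩ := exists_forall_eLpNorm_restrict_le_areaW him t (isCompact_closedBall z₀ δ) hδK
  obtain ⟨M, hM⟩ := exists_forall_enorm_le_mul_eLpNorm_ball ℂ ht (half_pos hδ)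
  refine ⟨δ / 2, half_pos hδ, M * C, fun z hz f hf => ?_⟩
  have hball : Metric.ball z (δ / 2) ⊆ Metric.closedBall z₀ δ :=
    (Metric.ball_subset_ball' (by linarith [Metric.mem_ball.1 hz])).trans
      Metric.ball_subset_closedBall
  calc ‖f z‖ₑ ≤ M * eLpNorm f t (volume.restrict (Metric.ball z (δ / 2))) :=
        hM z f (hf.mono (hball.trans hδK))
    _ ≤ M * (C * eLpNorm f t (areaW K)) := by
        gcongr
        exact (eLpNorm_mono_measure f (Measure.restrict_mono_set volume hball)).trans (hC f)
    _ = (M * C : ℝ≥0) * eLpNorm f t (areaW K) := by rw [ENNReal.coe_mul, mul_assoc]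

theorem abpe_areaW (him : ∀ z ∈ Om K, z.im ≠ 0) (ht : 1 ≤ t) : abpe K t (areaW K) = Om K := by
  have hbound : ∀ z₀ ∈ Om K, ∃ ρ > 0, ∃ M : ℝ≥0, ∀ z ∈ Metric.ball z₀ ρ, ∀ f ∈ Rat K,
      ‖f z‖ₑ ≤ M * eLpNorm f t (areaW K) := fun z₀ hz₀ => by
    obtain ⟨ρ, hρ, M, hM⟩ := exists_forall_ball_enorm_le_mul_eLpNorm_areaW him ht hz₀
    exact ⟨ρ, hρ, M, fun z hz f hf =>
      hM z hz f ((differentiableOn_of_mem_Rat hf).mono interior_subset)⟩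
  have hbpe : Om K ⊆ bpe K t (areaW K) := fun z hz => by
    obtain ⟨ρ, hρ, M, hM⟩ := hbound z hz
    exact ⟨interior_subset hz, M, hM z (Metric.mem_ball_self hρ)⟩
  refine Set.Subset.antisymm (fun z hz => interior_mono (fun _ h => h.1) hz.1) fun z hz => ?_
  exact ⟨interior_maximal hbpe (isOpen_Om K) hz, hbound z hz⟩

end PointEvaluations

section Purity

variable {K : Set ℂ} {t : ℝ≥0∞} {μ : Measure ℂ} {f : ℂ → ℂ}

theorem isOpen_abpe (K : Set ℂ) (t : ℝ≥0∞) (μ : Measure ℂ) : IsOpen (abpe K t μ) := by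
  refine isOpen_iff_mem_nhds.2 fun z₀ ⟨hz₀, r, hr, M, hM⟩ => ?_
  filter_upwards [isOpen_interior.mem_nhds hz₀, Metric.ball_mem_nhds z₀ hr] with z hz hzr
  obtain ⟨δ, hδ, hsub⟩ := Metric.isOpen_iff.1 Metric.isOpen_ball z hzr
  exact ⟨hz, δ, hδ, M, fun w hw => hM w (hsub hw)⟩

theorem uniformCauchySeqOn_of_tendsto_eLpNorm {S : Set ℂ} (hS : S ⊆ K) {M : ℝ≥0}
    (hM : ∀ z ∈ S, ∀ f ∈ Rat K, ‖f z‖ₑ ≤ M * eLpNorm f t μ) (hμ : ∀ᵐ z ∂μ, z ∈ K) (ht : 1 ≤ t)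
    {u : ℕ → ℂ → ℂ} (hu : ∀ n, u n ∈ Rat K ∧ MemLp (u n) t μ) (hf : MemLp f t μ)
    (hlim : Filter.Tendsto (fun n => eLpNorm (u n - f) t μ) Filter.atTop (nhds 0)) :
    UniformCauchySeqOn u Filter.atTop S := by
  set e : ℕ → ℝ≥0∞ := fun n => eLpNorm (u n - f) t μ
  have hdiff : ∀ m n, ∀ z ∈ S, edist (u m z) (u n z) ≤ M * (e m + e n) := by
    intro m n z hz
    obtain ⟨h, hh, heq⟩ := exists_mem_Rat_eqOn_sub (hu m).1 (hu n).1
    calc edist (u m z) (u n z) = ‖h z‖ₑ := by rw [edist_eq_enorm_sub, heq (hS hz), Pi.sub_apply]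
      _ ≤ M * eLpNorm h t μ := hM z hz h hh
      _ = M * eLpNorm ((u m - f) - (u n - f)) t μ := by
          rw [sub_sub_sub_cancel_right, eLpNorm_congr_ae (hμ.mono fun w hw => heq hw)]
      _ ≤ M * (e m + e n) := by
          gcongr
          exact eLpNorm_sub_le ((hu m).2.sub hf).1 ((hu n).2.sub hf).1 ht
  have hbound : Filter.Tendsto (fun p : ℕ × ℕ => M * (e p.1 + e p.2))
      (Filter.atTop ×ˢ Filter.atTop) (nhds 0) := by
    simpa using ENNReal.Tendsto.const_mul ((hlim.comp Filter.tendsto_fst).add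
      (hlim.comp Filter.tendsto_snd)) (.inr ENNReal.coe_ne_top)
  intro V hV
  obtain ⟨ε, hε, hεV⟩ := uniformity_basis_edist.mem_iff.1 hV
  filter_upwards [hbound.eventually_lt_const hε] with p hp z hz
  exact hεV ((hdiff p.1 p.2 z hz).trans_lt hp)

variable [Fact (1 ≤ t)]

theorem MemR.exists_differentiableOn_ae_eq (hμ : ∀ᵐ z ∂μ, z ∈ K) (hf : MemR K t μ f) :
    ∃ g : ℂ → ℂ, DifferentiableOn ℂ g (abpe K t μ) ∧ ∀ᵐ z ∂μ, z ∈ abpe K t μ → f z = g z := by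
  obtain ⟨u, hu, hlim⟩ := hf.exists_seq_tendsto hμ
  have hopen := isOpen_abpe K t μ
  have habpeK : abpe K t μ ⊆ K := fun z hz => (interior_subset hz.1).1
  have hcauchy : ∀ z ∈ abpe K t μ, ∃ V ∈ nhdsWithin z (abpe K t μ), V ⊆ abpe K t μ ∧ z ∈ V ∧
      UniformCauchySeqOn u Filter.atTop V := by
    rintro z ⟨hz, r, hr, M, hM⟩
    exact ⟨_, inter_mem_nhdsWithin _ (Metric.ball_mem_nhds z hr), Set.inter_subset_left,
      ⟨⟨hz, r, hr, M, hM⟩, Metric.mem_ball_self hr⟩,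
      uniformCauchySeqOn_of_tendsto_eLpNorm (Set.inter_subset_left.trans habpeK)
        (fun w hw => hM w hw.2) hμ Fact.out hu hf.memLp hlim⟩
  have hlimit : ∀ z ∈ abpe K t μ, ∃ w, Filter.Tendsto (fun n => u n z) Filter.atTop (nhds w) :=
    fun z hz => by
      obtain ⟨V, -, -, hzV, hV⟩ := hcauchy z hz
      exact cauchySeq_tendsto_of_complete (hV.cauchySeq hzV)
  choose! g hg using hlimit
  refine ⟨g, ?_, ?_⟩
  · refine TendstoLocallyUniformlyOn.differentiableOn (F := u) (φ := Filter.atTop)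
      (fun W hW z hz => ?_)
      (.of_forall fun n => (differentiableOn_of_mem_Rat (hu n).1).mono habpeK) hopen
    obtain ⟨V, hVz, hVA, -, hV⟩ := hcauchy z hz
    exact ⟨V, hVz, hV.tendstoUniformlyOn_of_tendsto (fun w hw => hg w (hVA hw)) W hW⟩
  · have hmeasure := tendstoInMeasure_of_tendsto_eLpNorm (zero_lt_one.trans_le Fact.out).ne'
      (fun n => (hu n).2.1) hf.memLp.1 hlim
    obtain ⟨ns, hns, hae⟩ := hmeasure.exists_seq_tendsto_ae
    filter_upwards [hae] with z hz hzA
    exact tendsto_nhds_unique hz ((hg z hzA).comp hns.tendsto_atTop)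

theorem eqOn_zero_of_continuousOn_of_ae {U : Set ℂ} {g : ℂ → ℂ} (hU : IsOpen U)
    (hpos : ∀ V ⊆ U, IsOpen V → V.Nonempty → μ V ≠ 0) (hg : ContinuousOn g U)
    (hae : ∀ᵐ z ∂μ, z ∈ U → g z = 0) : Set.EqOn g 0 U := by
  intro z hz
  by_contra hgz
  refine hpos (U ∩ g ⁻¹' {0}ᶜ) Set.inter_subset_left
    (hg.isOpen_inter_preimage hU isOpen_compl_singleton) ⟨z, hz, hgz⟩ (measure_mono_null ?_ hae)
  exact fun w hw hw0 => hw.2 (hw0 hw.1)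

theorem MemR.measure_eq_zero_of_indicator (hμ : ∀ᵐ z ∂μ, z ∈ K) {D U V : Set ℂ} (hU : IsOpen U)
    (hUconn : IsPreconnected U) (hUK : U ⊆ abpe K t μ)
    (hpos : ∀ W ⊆ U, IsOpen W → W.Nonempty → μ W ≠ 0) (hV : IsOpen V) (hVne : V.Nonempty)
    (hVU : V ⊆ U \ D) (hD : MemR K t μ (D.indicator fun _ => 1)) : μ (D ∩ U) = 0 := by
  obtain ⟨g, hg, hae⟩ := hD.exists_differentiableOn_ae_eq hμ
  have hgU : DifferentiableOn ℂ g U := hg.mono hUK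
  have hgV : Set.EqOn g 0 V := by
    refine eqOn_zero_of_continuousOn_of_ae hV
      (fun W hW => hpos W (hW.trans (hVU.trans Set.sdiff_subset)))
      (hgU.continuousOn.mono (hVU.trans Set.sdiff_subset)) (hae.mono fun z hz hzV => ?_)
    rw [← hz (hUK (hVU hzV).1), Set.indicator_of_notMem (hVU hzV).2]
  obtain ⟨v, hv⟩ := hVne
  have hgzero : Set.EqOn g 0 U :=
    (hgU.analyticOnNhd hU).eqOn_zero_of_preconnected_of_eventuallyEq_zero hUconn (hVU hv).1
      (hgV.eventuallyEq_of_mem (hV.mem_nhds hv))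
  refine measure_mono_null ?_ hae
  intro z hz h
  have := h (hUK hz.2)
  simp [hgzero hz.2, hz.1] at this

theorem memR_indicator_of_extendByZero_le [IsFiniteMeasure μ] {Δ D : Set ℂ} (hΔ : MeasurableSet Δ)
    (hR : extendByZero Δ ⊤ ≤ R K t μ) (hD : MeasurableSet D) (hDΔ : D ⊆ Δ) :
    MemR K t μ (D.indicator fun _ => 1) := by
  have hDLp : MemLp (D.indicator fun _ => (1 : ℂ)) t μ :=
    memLp_indicator_const t hD 1 (.inr (measure_ne_top μ D))
  refine (memR_iff_toLp_mem hDLp).2 (hR ((mem_extendByZero hΔ).2 ⟨Submodule.mem_top, ?_⟩))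
  filter_upwards [hDLp.coeFn_toLp] with z hz hzΔ
  rw [hz, Set.indicator_of_notMem fun hzD => hzΔ (hDΔ hzD)]

theorem isPure_of_ae_mem_abpe [IsFiniteMeasure μ] (hμ : ∀ᵐ z ∂μ, z ∈ abpe K t μ)
    (hpos : ∀ V ⊆ abpe K t μ, IsOpen V → V.Nonempty → μ V ≠ 0) : IsPure K t μ := by
  rintro ⟨Δ, hΔ, hΔpos, N, hR⟩
  have hμK : ∀ᵐ z ∂μ, z ∈ K := hμ.mono fun z hz => (interior_subset hz.1).1
  have hΔabpe : μ (Δ ∩ abpe K t μ) ≠ 0 := by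
    exact (measure_inter_conull (ae_iff.1 hμ)).trans_ne hΔpos.ne'
  obtain ⟨z₀, ⟨-, hz₀⟩, hz₀pos⟩ := exists_mem_forall_mem_nhdsWithin_pos_measure hΔabpe
  obtain ⟨δ, hδ, hδK⟩ := Metric.isOpen_iff.1 (isOpen_abpe K t μ) z₀ hz₀
  set D := Δ ∩ Metric.closedBall z₀ (δ / 2)
  have hD : MeasurableSet D := hΔ.inter Metric.isClosed_closedBall.measurableSet
  have hDR : MemR K t μ (D.indicator fun _ => 1) :=
    memR_indicator_of_extendByZero_le hΔ (hR ▸ le_sup_left) hD Set.inter_subset_left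
  have hann : (Metric.ball z₀ δ \ Metric.closedBall z₀ (δ / 2)).Nonempty := by
    have hnorm : ‖((3 / 4 * δ : ℝ) : ℂ)‖ = 3 / 4 * δ := by
      rw [Complex.norm_real, Real.norm_of_nonneg (by positivity)]
    refine ⟨z₀ + (3 / 4 * δ : ℝ), ?_, ?_⟩ <;>
      simp only [mem_ball_iff_norm, mem_closedBall_iff_norm, add_sub_cancel_left, hnorm] <;>
      linarith
  have hnull : μ (D ∩ Metric.ball z₀ δ) = 0 :=
    hDR.measure_eq_zero_of_indicator hμK Metric.isOpen_ball (convex_ball z₀ δ).isPreconnected hδK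
      (fun W hW => hpos W (hW.trans hδK)) (Metric.isOpen_ball.sdiff Metric.isClosed_closedBall) hann
      (Set.sdiff_subset_sdiff_right Set.inter_subset_right)
  refine (hz₀pos _ ?_).ne' hnull
  filter_upwards [self_mem_nhdsWithin, nhdsWithin_le_nhds (Metric.closedBall_mem_nhds z₀
    (half_pos hδ)), nhdsWithin_le_nhds (Metric.ball_mem_nhds z₀ hδ)] with z hz hzD hzB
  exact ⟨⟨hz.1, hzD⟩, hzB⟩

end Purity

section StringOfBeadsSet

variable {lam r : ℕ → ℝ}

theorem isCompact_beadSet (lam r : ℕ → ℝ) : IsCompact (beadSet lam r) :=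
  (isCompact_closedBall 0 1).diff (isOpen_iUnion fun _ => Metric.isOpen_ball)

namespace IsStringOfBeads

theorem finite_le_radius (h : IsStringOfBeads lam r) {ε : ℝ} (hε : 0 < ε) :
    {n | ε ≤ r n}.Finite := by
  have hfin : volume (⋃ n, Metric.ball (lam n : ℂ) (r n)) ≠ ∞ :=
    ((measure_mono (Set.iUnion_subset h.ball_subset)).trans_lt measure_ball_lt_top).ne
  refine (Measure.finite_const_le_meas_of_disjoint_iUnion (volume : Measure ℂ)
    (Metric.measure_ball_pos volume (0 : ℂ) hε) (fun n => measurableSet_ball)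
    (fun i j hij => (h.disjoint i j hij).mono Metric.ball_subset_closedBall
      Metric.ball_subset_closedBall) hfin).subset fun n hn => ?_
  rw [Set.mem_ofPred_eq, Measure.addHaar_ball_center volume (lam n : ℂ)]
  exact measure_mono (Metric.ball_subset_ball hn)

/-- A disk centred on the real axis that comes close to `z` has radius at least about `|Im z|`, and
only finitely many disks are that large. -/
theorem mem_Om (h : IsStringOfBeads lam r) {z : ℂ} (hz1 : ‖z‖ < 1) (him : z.im ≠ 0)
    (hz : ∀ n, z ∉ Metric.closedBall (lam n : ℂ) (r n)) : z ∈ Om (beadSet lam r) := by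
  have hη : 0 < |z.im| / 2 := by positivity
  have hfar : ∀ᶠ w in nhds z, ∀ n, |z.im| / 2 ≤ r n → w ∉ Metric.closedBall (lam n : ℂ) (r n) :=
    (Filter.eventually_all_finite (h.finite_le_radius hη)).2 fun n _ =>
      Metric.isClosed_closedBall.isOpen_compl.mem_nhds (hz n)
  have hhigh : ∀ᶠ w in nhds z, |z.im| / 2 < |w.im| :=
    Complex.continuous_im.abs.continuousAt.eventually_const_lt (by linarith)
  have hdisk : ∀ᶠ w in nhds z, ‖w‖ < 1 := continuous_norm.continuousAt.eventually_lt_const hz1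
  refine mem_interior_iff_mem_nhds.2 ?_
  filter_upwards [hfar, hhigh, hdisk] with w hwfar hwhigh hwdisk
  refine ⟨by simpa using hwdisk.le, fun hw => ?_⟩
  obtain ⟨n, hn⟩ := Set.mem_iUnion.1 hw
  refine hwfar n (hwhigh.le.trans ?_) (Metric.ball_subset_closedBall hn)
  have him_le := Complex.abs_im_le_norm (w - lam n)
  rw [Complex.sub_im, Complex.ofReal_im, sub_zero] at him_le
  exact him_le.trans (mem_ball_iff_norm.1 hn).le

theorem exists_abs_lt_one_mem (h : IsStringOfBeads lam r) :
    ∃ x : ℝ, |x| < 1 ∧ (x : ℂ) ∈ beadSet lam r := by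
  by_contra! hcon
  refine h.real_length_pos.ne' (measure_mono_null (t := {1, -1}) (fun x hx => ?_)
    ((Set.toFinite _).measure_zero volume))
  have hle : |x| ≤ 1 := by simpa using hx.1
  exact eq_or_eq_neg_of_abs_eq (le_antisymm hle (not_lt.1 fun hlt => hcon x hlt hx))

theorem add_mul_I_mem_Om (h : IsStringOfBeads lam r) {x y : ℝ} (hx : (x : ℂ) ∈ beadSet lam r)
    (hy : y ≠ 0) (hxy : |x| + |y| < 1) : (x + y * Complex.I : ℂ) ∈ Om (beadSet lam r) := by
  refine h.mem_Om ((norm_add_le _ _).trans_lt (by simpa using hxy)) (by simpa using hy)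
    fun n hn => hx.2 (Set.mem_iUnion.2 ⟨n, ?_⟩)
  -- vertical displacement strictly increases the distance to a centre on the real axis
  refine mem_ball_iff_norm.2 (lt_of_lt_of_le ?_ (mem_closedBall_iff_norm.1 hn))
  rw [← sq_lt_sq₀ (norm_nonneg _) (norm_nonneg _), Complex.sq_norm, Complex.sq_norm,
    Complex.normSq_apply, Complex.normSq_apply]
  simpa using mul_self_pos.2 hy

theorem nonempty_OmU (h : IsStringOfBeads lam r) : (OmU (beadSet lam r)).Nonempty := by
  obtain ⟨x, hx1, hx⟩ := h.exists_abs_lt_one_mem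
  obtain ⟨y, hy0, hy⟩ := exists_between (sub_pos.2 hx1)
  refine ⟨x + y * Complex.I, h.add_mul_I_mem_Om hx hy0.ne' ?_, by simpa using hy0⟩
  rw [abs_of_pos hy0]
  linarith

theorem nonempty_OmL (h : IsStringOfBeads lam r) : (OmL (beadSet lam r)).Nonempty := by
  obtain ⟨x, hx1, hx⟩ := h.exists_abs_lt_one_mem
  obtain ⟨y, hy0, hy⟩ := exists_between (sub_pos.2 hx1)
  refine ⟨x + (-y : ℝ) * Complex.I, h.add_mul_I_mem_Om hx (neg_ne_zero.2 hy0.ne') ?_,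
    fun hU => hy0.not_gt (by simpa using hU.2)⟩
  rw [abs_neg, abs_of_pos hy0]
  linarith

end IsStringOfBeads

end StringOfBeadsSet

end StringOfBeads

open StringOfBeads in
theorem mainTheorem5_general {K : Set ℂ} (hK : IsCompact K)
    (hint : interior {x : ℝ | (x : ℂ) ∈ K} = ∅) (hU : (OmU K).Nonempty) (hL : (OmL K).Nonempty) :
    IsPure K 2 (areaW K) ∧
    abpe K 2 (areaW K) = Om K ∧
    (∃ f ∈ R K 2 (areaW K), f =ᵐ[areaW K] (OmU K).indicator (fun _ => (1 : ℂ))) ∧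
    R K 2 (areaW K) =
      extendByZero (OmU K) (R (KU K) 2 ((areaW K).restrict (OmU K))) ⊔
        extendByZero (OmL K) (R (KL K) 2 ((areaW K).restrict (OmL K))) ∧
    extendByZero (OmU K) (R (KU K) 2 ((areaW K).restrict (OmU K))) ⟂
      extendByZero (OmL K) (R (KL K) 2 ((areaW K).restrict (OmL K))) ∧
    0 < areaW K (OmU K) ∧ 0 < areaW K (OmL K) := by
  have him : ∀ z ∈ Om K, z.im ≠ 0 := fun z => im_ne_zero_of_mem_Om hint
  have hpos : ∀ V ⊆ Om K, IsOpen V → V.Nonempty → areaW K V ≠ 0 :=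
    fun V hVK hV hne => areaW_ne_zero_of_isOpen him hV hne hVK
  have habpe : abpe K 2 (areaW K) = Om K := abpe_areaW him one_le_two
  have ht : (2 : ℝ≥0∞) ≤ 4 := by norm_num
  have := isFiniteMeasure_areaW hK
  refine ⟨isPure_of_ae_mem_abpe ?_ ?_, habpe, memR_indicator_OmU ht hK hint,
    R_areaW_eq_sup ht hK hint, extendByZero_isOrtho (isOpen_OmU K).measurableSet
      (isOpen_OmL him).measurableSet Set.disjoint_sdiff_right _ _,
    (hpos _ Set.inter_subset_left (isOpen_OmU K) hU).pos,
    (hpos _ Set.sdiff_subset (isOpen_OmL him) hL).pos⟩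
  · exact habpe ▸ ae_mem_Om K
  · exact habpe ▸ hpos

open StringOfBeads in
theorem mainTheorem5 (lam r : ℕ → ℝ) (h : IsStringOfBeads lam r)
    (K : Set ℂ) (hK : K = beadSet lam r) :
    -- multiplication by `z` on `R²(K, W dA)` is pure
    IsPure K 2 (areaW K) ∧
    -- the set of analytic bounded point evaluations is `Ω`
    abpe K 2 (areaW K) = Om K ∧
    -- the characteristic function of `Ω_U` is in `R²(K, W dA)`
    (∃ f ∈ R K 2 (areaW K), f =ᵐ[areaW K] (OmU K).indicator (fun _ => (1 : ℂ))) ∧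
    -- `R²(K, W dA) = R²(K_U, W dA|Ω_U) ⊕ R²(K_L, W dA|Ω_L)`, an orthogonal direct sum,
    -- and neither part is trivial
    R K 2 (areaW K) =
      extendByZero (OmU K) (R (KU K) 2 ((areaW K).restrict (OmU K))) ⊔
        extendByZero (OmL K) (R (KL K) 2 ((areaW K).restrict (OmL K))) ∧
    extendByZero (OmU K) (R (KU K) 2 ((areaW K).restrict (OmU K))) ⟂
      extendByZero (OmL K) (R (KL K) 2 ((areaW K).restrict (OmL K))) ∧
    0 < areaW K (OmU K) ∧ 0 < areaW K (OmL K) :=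
  hK ▸ mainTheorem5_general (isCompact_beadSet lam r) h.real_interior h.nonempty_OmU h.nonempty_OmL
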